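/- Let $n\ge 1$, let $A$ be a real $n\times n$ matrix all of whose complex eigenvalues have modulus larger than $1$, and suppose that $m=|\det A|$ is an integer larger than $1$. Let $D\subset\mathbb{R}^n$ be a set of $m$ vectors, and let $T=T(A,D)$ be the unique non-empty compact set with $T=\bigcup_{d\in D}A^{-1}(T+d)$. Suppose that $T$ has non-empty interior (that is, $T$ is a self-affine tile), and that $T$ has a polyhedral corner: there are $x_0\in T$, $r>0$ and a set $C=\{\lambda_1a_1+\dots+\lambda_ka_k:\lambda_i\ge 0\}$, where $a_1,\dots,a_k\in\mathbb{R}^n$ satisfy $\langle a_j,\beta\rangle>0$ for all $j$ for some non-zero $\beta\in\mathbb{R}^n$, such that $$B(x_0,r)\cap T=x_0+\bigl(B(0,r)\cap C\bigr),$$ where $B(x,r)$ denotes the Euclidean ball. Let $\mathbb{R}^+=[0,\infty)$. Then: 1. There is an invertible affine map $\varphi:\mathbb{R}^n\to\mathbb{R}^n$ such that $\varphi(T)$ is an $(\mathbb{R}^+)^n$-tile, i.e. there is a discrete set $J\subset\mathbb{R}^n$ such that $\varphi(T)+J=(\mathbb{R}^+)^n$ and the sets $\varphi(T)+t_1$ and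 $\varphi(T)+t_2$ intersect in a set of Lebesgue measure zero for all $t_1\ne t_2$ in $J$. 2. Consequently, $T$ is up to an affine map a finite union of translates of unit cubes: there are an invertible affine map $\psi:\mathbb{R}^n\to\mathbb{R}^n$ and a finite set $E$ of vectors with non-negative integer coordinates such that $\psi(T)=E+[0,1]^n$. -/

import Mathlib

open scoped Pointwise

/-- A real square matrix is expanding if all its (complex) eigenvalues have modulus
larger than `1`. -/
def IsExpanding {n : ℕ} (A : Matrix (Fin n) (Fin n) ℝ) : Prop :=
  ∀ μ ∈ spectrum ℂ (A.map (fun r : ℝ => (r : ℂ))), 1 < ‖μ‖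

/-- `T` is a non-empty compact set with `T = ⋃_{d ∈ D} A⁻¹ (T + d)`. For an expanding matrix `A` and
a non-empty finite set `D` exactly one set has this property; it is denoted `T(A, D)`. -/
structure IsSelfAffineSet {n : ℕ} (A : Matrix (Fin n) (Fin n) ℝ)
    (D : Finset (EuclideanSpace ℝ (Fin n))) (T : Set (EuclideanSpace ℝ (Fin n))) : Prop where
  nonempty : T.Nonempty
  isCompact : IsCompact T
  set_eq : T = ⋃ d ∈ D, (fun x => Matrix.toEuclideanLin A⁻¹ (x + d)) '' T

/-- `T` is the self-affine tile `T(A, D)`: the matrix `A` is expanding, `|det A|` is an integer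
larger than `1`, the digit set `D` has `|det A|` elements, and `T = T(A, D)` has interior points. -/
structure IsSelfAffineTile {n : ℕ} (A : Matrix (Fin n) (Fin n) ℝ)
    (D : Finset (EuclideanSpace ℝ (Fin n))) (T : Set (EuclideanSpace ℝ (Fin n))) : Prop where
  isExpanding : IsExpanding A
  one_lt_card : 1 < D.card
  abs_det_eq : |A.det| = (D.card : ℝ)
  isSelfAffineSet : IsSelfAffineSet A D T
  interior_nonempty : (interior T).Nonempty

/-- A convex polyhedral cone: all non-negative combinations of finitely many vectors
that lie in an open half space. -/
def IsConvexPolyhedralCone {n : ℕ} (C : Set (EuclideanSpace ℝ (Fin n))) : Prop :=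
  ∃ (m : ℕ) (a : Fin m → EuclideanSpace ℝ (Fin n)) (β : EuclideanSpace ℝ (Fin n)),
    β ≠ 0 ∧ (∀ j, 0 < inner ℝ (a j) β) ∧
      C = {x | ∃ c : Fin m → ℝ, (∀ j, 0 ≤ c j) ∧ x = ∑ j, c j • a j}

/-- `T` has a polyhedral corner: `B(x₀, r) ∩ T = x₀ + (B(0, r) ∩ C)` for some point `x₀ ∈ T`, some
`r > 0` and some convex polyhedral cone `C`. -/
def HasPolyhedralCorner {n : ℕ} (T : Set (EuclideanSpace ℝ (Fin n))) : Prop :=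
  ∃ x₀ ∈ T, ∃ r : ℝ, 0 < r ∧ ∃ C : Set (EuclideanSpace ℝ (Fin n)), IsConvexPolyhedralCone C ∧
    Metric.ball x₀ r ∩ T = (fun x => x₀ + x) '' (Metric.ball 0 r ∩ C)

/-- `(T, J)` is a packing of `X`: `T + J ⊆ X`, and distinct translates of `T` by elements of `J`
are disjoint in Lebesgue measure. -/
def IsPacking {n : ℕ} (X T J : Set (EuclideanSpace ℝ (Fin n))) : Prop :=
  T + J ⊆ X ∧ ∀ t₁ ∈ J, ∀ t₂ ∈ J, t₁ ≠ t₂ →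
    MeasureTheory.volume (((fun x => x + t₁) '' T) ∩ ((fun x => x + t₂) '' T)) = 0

/-- `(T, J)` is a covering of `X`. -/
def IsCovering {n : ℕ} (X T J : Set (EuclideanSpace ℝ (Fin n))) : Prop :=
  X ⊆ T + J

/-- `(T, J)` is a translation tiling of `X`, for a compact set `T` and a discrete set `J`. -/
structure IsTranslationTiling {n : ℕ} (X T J : Set (EuclideanSpace ℝ (Fin n))) : Prop where
  isCompact : IsCompact T
  isDiscrete : IsDiscrete J
  isPacking : IsPacking X T J
  isCovering : IsCovering X T J

/-- `T` is an `X`-tile. -/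
def IsTileOf {n : ℕ} (X T : Set (EuclideanSpace ℝ (Fin n))) : Prop :=
  ∃ J : Set (EuclideanSpace ℝ (Fin n)), IsTranslationTiling X T J

/-- The orthant `(ℝ⁺)ⁿ`, where `ℝ⁺ = {x ∈ ℝ : x ≥ 0}`. -/
def orthant (n : ℕ) : Set (EuclideanSpace ℝ (Fin n)) :=
  {x | ∀ i, 0 ≤ x i}

/-- The set `(ℤ⁺)ⁿ` of points with non-negative integer coordinates. -/
def integerOrthant (n : ℕ) : Set (EuclideanSpace ℝ (Fin n)) :=
  {x | ∀ i, ∃ k : ℕ, x i = k}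

/-- The unit cube `[0, 1]ⁿ`. -/
def unitCube (n : ℕ) : Set (EuclideanSpace ℝ (Fin n)) :=
  {x | ∀ i, 0 ≤ x i ∧ x i ≤ 1}

/-! Write `M` for the map of `A`, so that `M T = T + D`. Iterating cuts `T` into arbitrarily small
copies `M⁻ᵏ(T + t)`. A volume count makes their overlaps null, and `T` is the closure of its
interior, so distinct pieces share no interior point. Zooming in at the corner, small affine copies
of `T`, all translates of one another, tile the cone `C` near its apex (`exists_basis_of_corner`).
It remains to see which small sets can do this.

Take a minimal system of generators, so that each spans an extreme ray, and scale each `a i` to the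
first nonzero translation vector on its ray. Near `a i` the base tile then contains `C` minus `a i +
C`. If `y` is outside `C` while `y + M • a i` and `y + M' • a j` are in `C`, then `a i + ε y` and `a
j + ε y` both lie in the base tile, so its translates by `a i` and `a j` overlap at `a i + a j + ε
y`. This contradiction (`mem_genCone_of_pair`) forces the generators to be independent
(`linearIndependent_of_genCone`), and `C` becomes the orthant. The same overlap trick, in an
induction over unit cells, makes the relevant translation vectors integral and the tile a union of
cells (`openCell_full_or_empty`). This is the second claim.

For the first claim, `M` need not preserve the orthant. The piece at the origin in the `k`-th
subdivision marks a point `x k` of `T` at which `T` has the germ of the cone `Mᵏ(orthant)`. Such a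
point has integer coordinates, so two of them coincide, and a positive power of `M` preserves the
orthant. Its iterates blow `T` up to a tiling of the orthant (`isTileOf_orthant`). -/

/-! ### Unit cells and local tilings of the orthant -/

/-- The open unit cell of `ℝ^ι` with lower corner `k`. -/
def openCell {ι : Type*} (k : ι → ℕ) : Set (ι → ℝ) :=
  {x | ∀ i, (k i : ℝ) < x i ∧ x i < k i + 1}

theorem isOpen_openCell {ι : Type*} [Finite ι] (k : ι → ℕ) : IsOpen (openCell k) := by
  have : openCell k = Set.univ.pi fun i => Set.Ioo (k i : ℝ) (k i + 1) := by
    ext x; simp [openCell, Set.mem_pi]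
  rw [this]
  exact isOpen_set_pi Set.finite_univ fun i _ => isOpen_Ioo

open Filter Topology in
/-- A small shift of `t` along `v` lies in the cell containing `t`, when `v` is positive in the
coordinates where `t` is on the boundary of that cell. -/
theorem eventually_add_smul_mem_openCell {ι : Type*} [Finite ι] {k : ι → ℕ} {t v : ι → ℝ}
    (h : ∀ i, (k i : ℝ) ≤ t i ∧ t i < k i + 1) (hv : ∀ i, 0 < v i ∨ (k i : ℝ) < t i) :
    ∀ᶠ ε : ℝ in 𝓝[>] 0, t + ε • v ∈ openCell k := by
  have key : ∀ i, ∀ᶠ ε : ℝ in 𝓝[>] 0, (k i : ℝ) < t i + ε * v i ∧ t i + ε * v i < k i + 1 := by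
    intro i
    have hc : Tendsto (fun ε : ℝ => t i + ε * v i) (𝓝[>] 0) (𝓝 (t i)) := by
      have : Continuous fun ε : ℝ => t i + ε * v i := by fun_prop
      simpa using (this.tendsto 0).mono_left nhdsWithin_le_nhds
    have h2 := hc.eventually (gt_mem_nhds (h i).2)
    rcases hv i with hv | hv
    · filter_upwards [h2, self_mem_nhdsWithin] with ε h2 hε
      have : 0 < ε * v i := mul_pos hε hv
      exact ⟨by linarith [(h i).1], h2⟩
    · filter_upwards [h2, hc.eventually (lt_mem_nhds hv)] with ε h2 h3
      exact ⟨h3, h2⟩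
  filter_upwards [eventually_all.2 key] with ε hε i
  simpa using hε i

theorem le_of_mem_openCell {ι : Type*} {k l : ι → ℕ} {t x : ι → ℝ}
    (hx : x ∈ openCell k) (ht : ∀ i, (l i : ℝ) ≤ t i) (htx : t ≤ x) : l ≤ k := by
  intro i
  have h1 := ht i
  have h2 := htx i
  have h3 := (hx i).2
  have : (l i : ℝ) < (k i + 1 : ℕ) := by push_cast; linarith
  exact Nat.lt_succ_iff.1 (by exact_mod_cast this)

open Filter Topology in
/-- Inductive step: in a local tiling of the orthant, each unit cell below a point of the tile is
either contained in the tile or disjoint from it, and contains no translation vector except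
possibly its lower corner. -/
theorem openCell_full_or_empty {ι : Type*} [Fintype ι] [DecidableEq ι] {T J : Set (ι → ℝ)}
    (hJ : J.Finite) (hTcl : IsClosed T) (hT0 : ∀ x ∈ T, 0 ≤ x)
    (h0T : ∀ᶠ x in 𝓝 (0 : ι → ℝ), 0 ≤ x → x ∈ T)
    (hJ0 : ∀ t ∈ J, 0 ≤ t) (h0J : 0 ∈ J) (heJ : ∀ i, Pi.single i 1 ∈ J)
    (hge : ∀ i, ∀ᶠ x in 𝓝 (Pi.single i 1 : ι → ℝ), 0 ≤ x → x i < 1 → x ∈ T)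
    (hcov : ∀ x, 0 ≤ x → ∀ z ∈ T, x ≤ z + 1 → ∃ t ∈ J, x - t ∈ T)
    (hdis : ∀ t ∈ J, ∀ t' ∈ J, ∀ x, x - t ∈ interior T → x - t' ∈ T → t = t')
    (k : ι → ℕ) (hk : ∃ z ∈ T, ∀ i, (k i : ℝ) ≤ z i) :
    (∀ t ∈ J, (∀ i, (k i : ℝ) ≤ t i ∧ t i < k i + 1) → ∀ i, t i = k i) ∧
      ((∀ x ∈ openCell k, x ∉ T) ∨ openCell k ⊆ T) := by
  induction k using WellFoundedLT.induction with
  | ind k IH =>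
  obtain ⟨z, hzT, hkz⟩ := hk
  have IH' : ∀ l : ι → ℕ, l ≤ k → l ≠ k →
      (∀ t ∈ J, (∀ i, (l i : ℝ) ≤ t i ∧ t i < l i + 1) → ∀ i, t i = l i) ∧
      ((∀ x ∈ openCell l, x ∉ T) ∨ openCell l ⊆ T) := fun l hl hlk =>
    IH l (lt_of_le_of_ne hl hlk)
      ⟨z, hzT, fun i => le_trans (by exact_mod_cast hl i) (hkz i)⟩
  have hcovQ : ∀ x ∈ openCell k, ∃ t ∈ J, x - t ∈ T := fun x hx =>
    hcov x (fun i => (Nat.cast_nonneg _).trans (hx i).1.le) z hzT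
      (fun i => by have := (hx i).2; have := hkz i; simp; linarith)
  -- a tile based in the cell meets the cell
  have hmeet : ∀ t ∈ J, (∀ i, (k i : ℝ) ≤ t i ∧ t i < k i + 1) →
      ∃ x ∈ openCell k, x - t ∈ T := by
    intro t _ htk
    have h1 := eventually_add_smul_mem_openCell (v := fun _ => (1 : ℝ)) htk
      (fun i => Or.inl one_pos)
    have h2 : Tendsto (fun ε : ℝ => ε • (fun _ : ι => (1 : ℝ))) (𝓝[>] 0) (𝓝 0) := by
      have : Continuous fun ε : ℝ => ε • (fun _ : ι => (1 : ℝ)) := by fun_prop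
      simpa using (this.tendsto 0).mono_left nhdsWithin_le_nhds
    obtain ⟨ε, h1, h2, hε⟩ := (h1.and ((h2.eventually h0T).and self_mem_nhdsWithin)).exists
    refine ⟨_, h1, ?_⟩
    rw [add_sub_cancel_left]
    exact h2 fun i => by simpa using (le_of_lt hε : (0 : ℝ) ≤ ε)
  -- if the cell lies in a translate other than the tile itself, everything follows
  have hfull : ∀ l : ι → ℕ, l ≠ 0 → (fun i => (l i : ℝ)) ∈ J →
      (∀ x ∈ openCell k, x - (fun i => (l i : ℝ)) ∈ interior T) →
      ((∀ t ∈ J, (∀ i, (k i : ℝ) ≤ t i ∧ t i < k i + 1) → t = fun i => (l i : ℝ)) ∧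
        (∀ x ∈ openCell k, x ∉ T)) := by
    intro l hl0 hl hint
    refine ⟨fun t ht htk => ?_, fun x hx hxT => hl0 ?_⟩
    · obtain ⟨x, hx, hxt⟩ := hmeet t ht htk
      exact (hdis _ hl t ht x (hint x hx) hxt).symm
    · have := hdis _ hl 0 h0J x (hint x hx) (by simpa using hxT)
      funext i
      simpa using congrFun this i
  have hsub : ∀ l : ι → ℕ, l ≤ k → openCell (k - l) ⊆ T →
      ∀ x ∈ openCell k, x - (fun i => (l i : ℝ)) ∈ interior T := by
    intro l hl hlT x hx
    refine interior_maximal hlT (isOpen_openCell _) fun i => ?_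
    have := hx i
    simp only [Pi.sub_apply, Nat.cast_sub (hl i)]
    constructor <;> linarith
  have hfloor : ∀ t ∈ J, ∀ i, ((⌊t i⌋₊ : ℕ) : ℝ) ≤ t i ∧ t i < (⌊t i⌋₊ : ℕ) + 1 := fun t ht i =>
    ⟨Nat.floor_le (hJ0 t ht i), Nat.lt_floor_add_one _⟩
  -- A translate based outside the cell: its base lies in a strictly smaller cell `l`, so it is
  -- integral by induction. The cell `k - l` is also smaller and meets `T`, hence is full, and the
  -- translate swallows the whole cell `k`.
  by_cases hA : ∃ t ∈ J, ¬ (∀ i, (k i : ℝ) ≤ t i ∧ t i < k i + 1) ∧ t ≠ 0 ∧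
      ∃ x ∈ openCell k, x - t ∈ T
  · obtain ⟨t, ht, htk, ht0, x, hx, hxt⟩ := hA
    set l : ι → ℕ := fun i => ⌊t i⌋₊ with hl
    have hlk : l ≤ k := le_of_mem_openCell hx (fun i => (hfloor t ht i).1)
      (sub_nonneg.1 (hT0 _ hxt))
    have hlk' : l ≠ k := by
      rintro rfl
      exact htk (hfloor t ht)
    have htl : t = fun i => (l i : ℝ) := funext ((IH' l hlk hlk').1 t ht (hfloor t ht))
    have hl0 : l ≠ 0 := by
      intro h
      apply ht0
      rw [htl, h]; funext i; simp
    have hne : k - l ≠ k := by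
      intro h
      apply hl0
      funext i
      have h1 := congrFun h i
      have h2 := hlk i
      simp only [Pi.sub_apply, Pi.zero_apply] at h1 h2 ⊢
      omega
    have hfulll : openCell (k - l) ⊆ T := by
      refine ((IH' (k - l) (fun i => Nat.sub_le _ _) hne).2).resolve_left fun h => ?_
      refine h _ ?_ hxt
      intro i
      have := hx i
      rw [htl]
      simp only [Pi.sub_apply, Nat.cast_sub (hlk i)]
      constructor <;> linarith
    rw [htl] at ht
    obtain ⟨h1, h2⟩ := hfull l hl0 ht (hsub l hlk hfulll)
    refine ⟨fun t' ht' htk' => ?_, Or.inl h2⟩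
    exfalso
    apply hlk'
    have := h1 t' ht' htk'
    funext i
    have h3 := htk' i
    rw [this] at h3
    have h3 : k i ≤ l i := by simpa using h3.1
    exact le_antisymm (hlk i) h3
  replace hA : ∀ t ∈ J, ¬ (∀ i, (k i : ℝ) ≤ t i ∧ t i < k i + 1) → t ≠ 0 →
      ∀ x ∈ openCell k, x - t ∉ T := fun t ht htk ht0 x hx hxt =>
    hA ⟨t, ht, htk, ht0, x, hx, hxt⟩
  by_cases hB : ∃ t ∈ J, (∀ i, (k i : ℝ) ≤ t i ∧ t i < k i + 1) ∧ t ≠ 0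
  · obtain ⟨t, ⟨ht, htk, ht0⟩, hmin⟩ := (hJ.subset (fun t ht => ht.1 :
      {t | t ∈ J ∧ (∀ i, (k i : ℝ) ≤ t i ∧ t i < k i + 1) ∧ t ≠ 0} ⊆ J)).exists_minimal hB
    -- Only translates containing `t` matter here, and their bases satisfy `t' ≤ t`. A nonzero such
    -- base lies in the cell by `hA`, so minimality gives `t' = t`.
    have hnear : ∀ᶠ x in 𝓝 t, x ∈ openCell k → x ∈ T ∨ x - t ∈ T := by
      have : ∀ᶠ x in 𝓝 t, ∀ t' ∈ J, t - t' ∉ T → x - t' ∉ T := by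
        rw [eventually_all_finite hJ]
        intro t' _
        by_cases h : t - t' ∈ T
        · exact Eventually.of_forall fun x hx => absurd h hx
        · have hc : ContinuousAt (fun x : ι → ℝ => x - t') t := by fun_prop
          filter_upwards [hc.eventually (hTcl.isOpen_compl.mem_nhds h)] with x hx _ using hx
      filter_upwards [this] with x hx hxQ
      obtain ⟨t', ht', hxt'⟩ := hcovQ x hxQ
      by_cases ht'0 : t' = 0
      · left; simpa [ht'0] using hxt'
      right
      have htt' : t - t' ∈ T := by
        by_contra h
        exact hx t' ht' h hxt'
      have hle : t' ≤ t := sub_nonneg.1 (hT0 _ htt')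
      have ht'k : ∀ i, (k i : ℝ) ≤ t' i ∧ t' i < k i + 1 := by
        by_contra h
        exact hA t' ht' h ht'0 x hxQ hxt'
      have : t = t' := le_antisymm (hmin ⟨ht', ht'k, ht'0⟩ hle) hle
      rwa [this]
    have htk' : t = fun i => (k i : ℝ) := by
      by_contra hne
      obtain ⟨i, hi⟩ := Function.ne_iff.1 hne
      have hi : (k i : ℝ) < t i := lt_of_le_of_ne (htk i).1 (Ne.symm hi)
      -- Moving along `v` stays in the cell but lowers coordinate `i`, leaving `T + t`; so `t + ε •
      -- v` is interior to `T`. By `hge`, `e_i + ε • v` is in `T`. Thus `T + e_i` and `T + t`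
      -- overlap at `t + e_i + ε • v`, forcing `t = e_i`, which contradicts `k i < t i < k i + 1`.
      set v : ι → ℝ := fun j => if j = i then -1 else 1 with hv
      have h1 := eventually_add_smul_mem_openCell (v := v) htk (fun j => by
        by_cases hj : j = i
        · subst hj; exact Or.inr hi
        · left; simp [hv, hj])
      have hc : Tendsto (fun ε : ℝ => t + ε • v) (𝓝[>] 0) (𝓝 t) := by
        have : Continuous fun ε : ℝ => t + ε • v := by fun_prop
        simpa using (this.tendsto 0).mono_left nhdsWithin_le_nhds
      have hc' : Tendsto (fun ε : ℝ => Pi.single i 1 + ε • v) (𝓝[>] 0)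
          (𝓝 (Pi.single i 1)) := by
        have : Continuous fun ε : ℝ => Pi.single i 1 + ε • v := by fun_prop
        simpa using (this.tendsto 0).mono_left nhdsWithin_le_nhds
      obtain ⟨ε, hε1, hε2, hε3, hε⟩ := (h1.and ((hc.eventually hnear.eventually_nhds).and
        ((hc'.eventually (hge i)).and (self_mem_nhdsWithin (a := (0 : ℝ)) (s := Set.Ioi 0))))).exists
      have hε : 0 < ε := hε
      have hint : t + ε • v ∈ interior T := by
        rw [mem_interior_iff_mem_nhds]
        have hlt : ∀ᶠ x in 𝓝 (t + ε • v), x i < t i := by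
          have hcc : ContinuousAt (fun x : ι → ℝ => x i) (t + ε • v) :=
            (continuous_apply i).continuousAt
          refine hcc.eventually (gt_mem_nhds ?_)
          simp [hv, hε]
        filter_upwards [hε2, hlt, (isOpen_openCell k).mem_nhds hε1] with x hx hxi hxQ
        refine (hx hxQ).resolve_right fun h => ?_
        have := hT0 _ h i
        simp at this
        linarith
      have hmem : Pi.single i 1 + ε • v ∈ T := by
        refine hε3 (fun j => ?_) ?_
        · by_cases hj : j = i
          · subst hj
            have := (hε1 j).1
            have h2 := (htk j).2
            have h3 : (t + ε • v) j = t j - ε := by simp [hv]; ring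
            rw [h3] at this
            simp [hv]
            linarith
          · simp [hv, hj, hε.le]
        · simp [hv, hε]
      have h2 : (Pi.single i 1 : ι → ℝ) = t := by
        refine hdis _ (heJ i) t ht (t + ε • v + Pi.single i 1) ?_ ?_
        · simpa using hint
        · convert hmem using 1
          abel
      have h3 : t i = 1 := by rw [← h2]; simp
      have h4 := (htk i).2
      rw [h3] at hi h4
      have h5 : k i < 1 := by exact_mod_cast hi
      have h6 : k i = 0 := by omega
      rw [h6] at h4
      simp at h4
    have hk0 : k ≠ 0 := by
      rintro rfl
      apply ht0
      rw [htk']; funext i; simp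
    have hfull0 : openCell (k - k) ⊆ T := by
      rw [show k - k = 0 by funext i; simp]
      refine ((IH' 0 (fun i => Nat.zero_le _) hk0.symm).2).resolve_left fun h => ?_
      have h1 := eventually_add_smul_mem_openCell (k := (0 : ι → ℕ)) (t := 0)
        (v := fun _ => (1 : ℝ)) (by simp) (fun i => Or.inl one_pos)
      have h2 : Tendsto (fun ε : ℝ => (0 : ι → ℝ) + ε • (fun _ : ι => (1 : ℝ))) (𝓝[>] 0)
          (𝓝 0) := by
        have : Continuous fun ε : ℝ => (0 : ι → ℝ) + ε • (fun _ : ι => (1 : ℝ)) := by fun_prop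
        simpa using (this.tendsto 0).mono_left nhdsWithin_le_nhds
      obtain ⟨ε, h1, h2⟩ := (h1.and (h2.eventually h0T)).exists
      exact h _ h1 (h2 fun i => by simpa using (h1 i).1.le)
    have htJ := ht
    rw [htk'] at htJ
    obtain ⟨h1, h2⟩ := hfull k hk0 htJ (hsub k le_rfl hfull0)
    exact ⟨fun t' ht' htk'' i => congrFun (h1 t' ht' htk'') i, Or.inl h2⟩
  · replace hB : ∀ t ∈ J, (∀ i, (k i : ℝ) ≤ t i ∧ t i < k i + 1) → t = 0 :=
      fun t ht htk => by_contra fun h => hB ⟨t, ht, htk, h⟩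
    refine ⟨fun t ht htk i => ?_, Or.inr fun x hx => ?_⟩
    · have := hB t ht htk
      subst this
      have := (htk i).1
      simp only [Pi.zero_apply] at this ⊢
      exact le_antisymm (Nat.cast_nonneg _) this
    · obtain ⟨t, ht, hxt⟩ := hcovQ x hx
      have : t = 0 := by
        by_contra h0
        by_cases h : ∀ i, (k i : ℝ) ≤ t i ∧ t i < k i + 1
        · exact h0 (hB t ht h)
        · exact hA t ht h h0 x hx hxt
      simpa [this] using hxt

open Filter Topology in
/-- A compact regular set that tiles the orthant locally, with the unit vectors among the
translation vectors, is a union of unit cells. -/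
theorem exists_eq_union_cells {ι : Type*} [Fintype ι] [DecidableEq ι] {T J : Set (ι → ℝ)}
    (hJ : J.Finite) (hTc : IsCompact T) (hreg : T ⊆ closure (interior T)) (hT0 : ∀ x ∈ T, 0 ≤ x)
    (h0T : ∀ᶠ x in 𝓝 (0 : ι → ℝ), 0 ≤ x → x ∈ T)
    (hJ0 : ∀ t ∈ J, 0 ≤ t) (h0J : 0 ∈ J) (heJ : ∀ i, Pi.single i 1 ∈ J)
    (hge : ∀ i, ∀ᶠ x in 𝓝 (Pi.single i 1 : ι → ℝ), 0 ≤ x → x i < 1 → x ∈ T)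
    (hcov : ∀ x, 0 ≤ x → ∀ z ∈ T, x ≤ z + 1 → ∃ t ∈ J, x - t ∈ T)
    (hdis : ∀ t ∈ J, ∀ t' ∈ J, ∀ x, x - t ∈ interior T → x - t' ∈ T → t = t') :
    ∃ K : Finset (ι → ℕ), 0 ∈ K ∧
      T = {x | ∃ k ∈ K, ∀ i, (k i : ℝ) ≤ x i ∧ x i ≤ (k i : ℝ) + 1} := by
  have hTcl := hTc.isClosed
  -- cells that meet `T` are contained in `T`
  have hcell : ∀ k : ι → ℕ, (∃ x ∈ openCell k, x ∈ T) → openCell k ⊆ T := by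
    rintro k ⟨x, hx, hxT⟩
    refine ((openCell_full_or_empty hJ hTcl hT0 h0T hJ0 h0J heJ hge hcov hdis k
      ⟨x, hxT, fun i => (hx i).1.le⟩).2).resolve_left fun h => h x hx hxT
  have hclos : ∀ k : ι → ℕ, openCell k ⊆ T →
      ∀ x : ι → ℝ, (∀ i, (k i : ℝ) ≤ x i ∧ x i ≤ k i + 1) → x ∈ T := by
    intro k hk x hx
    have hpi : openCell k = Set.univ.pi fun i => Set.Ioo (k i : ℝ) (k i + 1) := by
      ext x; simp [openCell, Set.mem_pi]
    have : x ∈ closure (openCell k) := by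
      rw [hpi, closure_pi_set]
      intro i _
      have hne : (k i : ℝ) ≠ k i + 1 := by simp
      simpa only [closure_Ioo hne] using Set.mem_Icc.2 (hx i)
    exact closure_minimal hk hTcl this
  obtain ⟨R, hR⟩ := hTc.isBounded.exists_norm_le
  have hfin : {k : ι → ℕ | openCell k ⊆ T}.Finite := by
    refine (Set.finite_Iic (fun _ : ι => ⌊R⌋₊)).subset fun k hk i => ?_
    have h1 := hR _ (hclos k hk (fun i => (k i : ℝ)) (fun i => ⟨le_rfl, by simp⟩))
    have h2 := (norm_le_pi_norm (fun i => (k i : ℝ)) i).trans h1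
    simp at h2
    exact Nat.le_floor h2
  refine ⟨hfin.toFinset, ?_, ?_⟩
  · rw [Set.Finite.mem_toFinset]
    apply hcell
    have h1 := eventually_add_smul_mem_openCell (k := (0 : ι → ℕ)) (t := 0)
      (v := fun _ => (1 : ℝ)) (by simp) (fun i => Or.inl one_pos)
    have h2 : Tendsto (fun ε : ℝ => (0 : ι → ℝ) + ε • (fun _ : ι => (1 : ℝ))) (𝓝[>] 0)
        (𝓝 0) := by
      have : Continuous fun ε : ℝ => (0 : ι → ℝ) + ε • (fun _ : ι => (1 : ℝ)) := by fun_prop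
      simpa using (this.tendsto 0).mono_left nhdsWithin_le_nhds
    obtain ⟨ε, h1, h2⟩ := (h1.and (h2.eventually h0T)).exists
    exact ⟨_, h1, h2 fun i => by simpa using (h1 i).1.le⟩
  · apply Set.Subset.antisymm
    · have hcl : IsClosed {x : ι → ℝ | ∃ k ∈ hfin.toFinset,
          ∀ i, (k i : ℝ) ≤ x i ∧ x i ≤ k i + 1} := by
        have : {x : ι → ℝ | ∃ k ∈ hfin.toFinset, ∀ i, (k i : ℝ) ≤ x i ∧ x i ≤ k i + 1} =
            ⋃ k ∈ hfin.toFinset, Set.Icc (fun i => (k i : ℝ)) (fun i => (k i : ℝ) + 1) := by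
          ext x; simp only [Set.mem_iUnion, exists_prop, Set.mem_Icc, Pi.le_def, forall_and,
            Set.mem_ofPred_eq]
        rw [this]
        exact hfin.toFinset.finite_toSet.isClosed_biUnion fun k _ => isClosed_Icc
      refine hreg.trans (closure_minimal (fun y hy => ?_) hcl)
      have hy0 := hT0 y (interior_subset hy)
      have hfl : ∀ i, ((⌊y i⌋₊ : ℕ) : ℝ) ≤ y i ∧ y i < (⌊y i⌋₊ : ℕ) + 1 := fun i =>
        ⟨Nat.floor_le (hy0 i), Nat.lt_floor_add_one _⟩
      refine ⟨fun i => ⌊y i⌋₊, ?_, fun i => ⟨(hfl i).1, (hfl i).2.le⟩⟩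
      rw [Set.Finite.mem_toFinset]
      apply hcell
      -- A diagonal push moves an interior point lying on a cell wall into the open cell while
      -- staying in `T`.
      have h1 := eventually_add_smul_mem_openCell (v := fun _ => (1 : ℝ)) hfl
        (fun i => Or.inl one_pos)
      have h2 : Tendsto (fun ε : ℝ => y + ε • (fun _ : ι => (1 : ℝ))) (𝓝[>] 0) (𝓝 y) := by
        have : Continuous fun ε : ℝ => y + ε • (fun _ : ι => (1 : ℝ)) := by fun_prop
        simpa using (this.tendsto 0).mono_left nhdsWithin_le_nhds
      obtain ⟨ε, h1, h2⟩ := (h1.and (h2.eventually (mem_interior_iff_mem_nhds.1 hy))).exists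
      exact ⟨_, h1, h2⟩
    · rintro x ⟨k, hk, hx⟩
      exact hclos k (hfin.mem_toFinset.1 hk) x hx

/-! ### Finitely generated cones -/

/-- The set of non-negative combinations of the vectors `a j`. -/
def genCone {E ι : Type*} [AddCommGroup E] [Module ℝ E] [Fintype ι] (a : ι → E) : Set E :=
  {x | ∃ c : ι → ℝ, (∀ j, 0 ≤ c j) ∧ x = ∑ j, c j • a j}

section GenCone

variable {E ι : Type*} [AddCommGroup E] [Module ℝ E] [Fintype ι] {a : ι → E} {β : E →ₗ[ℝ] ℝ}

theorem genCone_zero_mem : (0 : E) ∈ genCone a := ⟨0, by simp, by simp⟩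

theorem genCone_add_mem {x y : E} (hx : x ∈ genCone a) (hy : y ∈ genCone a) :
    x + y ∈ genCone a := by
  obtain ⟨c, hc, rfl⟩ := hx
  obtain ⟨d, hd, rfl⟩ := hy
  exact ⟨c + d, fun j => add_nonneg (hc j) (hd j), by simp [add_smul, Finset.sum_add_distrib]⟩

theorem genCone_smul_mem {x : E} {s : ℝ} (hs : 0 ≤ s) (hx : x ∈ genCone a) :
    s • x ∈ genCone a := by
  obtain ⟨c, hc, rfl⟩ := hx
  exact ⟨s • c, fun j => mul_nonneg hs (hc j), by simp [Finset.smul_sum, smul_smul]⟩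

theorem genCone_self_mem (i : ι) : a i ∈ genCone a := by
  classical
  exact ⟨Pi.single i 1, fun j => by
    by_cases h : j = i
    · subst h; simp
    · simp [h], by simp [Pi.single_apply, ite_smul]⟩

theorem genCone_nonneg (hβ : ∀ j, 0 < β (a j)) {x : E} (hx : x ∈ genCone a) : 0 ≤ β x := by
  obtain ⟨c, hc, rfl⟩ := hx
  simp only [map_sum, map_smul, smul_eq_mul]
  exact Finset.sum_nonneg fun j _ => mul_nonneg (hc j) (hβ j).le

theorem genCone_eq_zero (hβ : ∀ j, 0 < β (a j)) {x : E} (hx : x ∈ genCone a) (h0 : β x ≤ 0) :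
    x = 0 := by
  obtain ⟨c, hc, rfl⟩ := hx
  simp only [map_sum, map_smul, smul_eq_mul] at h0
  have h1 := (Finset.sum_eq_zero_iff_of_nonneg fun j _ => mul_nonneg (hc j) (hβ j).le).1
    (le_antisymm h0 (Finset.sum_nonneg fun j _ => mul_nonneg (hc j) (hβ j).le))
  refine Finset.sum_eq_zero fun j hj => ?_
  have := (mul_eq_zero.1 (h1 j hj)).resolve_right (hβ j).ne'
  simp [this]

theorem genCone_smul_eq {s : ι → ℝ} (hs : ∀ i, 0 < s i) :
    genCone (fun i => s i • a i) = genCone a := by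
  ext x
  constructor
  · rintro ⟨c, hc, rfl⟩
    exact ⟨fun i => c i * s i, fun i => mul_nonneg (hc i) (hs i).le, by simp [smul_smul]⟩
  · rintro ⟨c, hc, rfl⟩
    refine ⟨fun i => c i / s i, fun i => div_nonneg (hc i) (hs i).le,
      Finset.sum_congr rfl fun i _ => ?_⟩
    rw [smul_smul, div_mul_cancel₀ _ (hs i).ne']

/-- Every finitely generated cone has a minimal system of generators. -/
theorem exists_minimal_generators (a : ι → E) : ∃ S : Finset ι,
    genCone (fun j : S => a j) = genCone a ∧
    ∀ i : S, ∀ c : S → ℝ, (∀ j, 0 ≤ c j) → c i = 0 → a i ≠ ∑ j, c j • a j := by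
  classical
  let P : Finset ι → Prop := fun S => genCone (fun j : S => a j) = genCone a
  have huniv : P Finset.univ := by
    ext x
    constructor
    · rintro ⟨c, hc, rfl⟩
      exact ⟨fun i => c ⟨i, Finset.mem_univ i⟩, fun i => hc _,
        Finset.sum_coe_sort Finset.univ fun i => c ⟨i, Finset.mem_univ i⟩ • a i⟩
    · rintro ⟨c, hc, rfl⟩
      exact ⟨fun i => c i, fun i => hc _,
        (Finset.sum_coe_sort Finset.univ fun i => c i • a i).symm⟩
  obtain ⟨S, hS, hmin⟩ := (Set.toFinite {S | P S}).exists_minimal ⟨_, huniv⟩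
  refine ⟨S, hS, fun i c hc hci hai => ?_⟩
  have hP : P (S.erase i) := by
    show _ = _
    rw [← (show _ = _ from hS)]
    ext x
    constructor
    · rintro ⟨d, hd, rfl⟩
      refine ⟨fun j => if h : (j : ι) ∈ S.erase i then d ⟨j, h⟩ else 0, fun j => ?_, ?_⟩
      · dsimp only; split_ifs
        · exact hd _
        · exact le_rfl
      · have h1 := Finset.sum_coe_sort (S.erase i)
          fun j => (if h : j ∈ S.erase i then d ⟨j, h⟩ else 0) • a j
        have h2 := Finset.sum_coe_sort S
          fun j => (if h : j ∈ S.erase i then d ⟨j, h⟩ else 0) • a j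
        rw [h2, ← Finset.sum_erase (a := (i : ι)) S (by simp), ← h1]
        exact Finset.sum_congr rfl fun j _ => by simp [j.2]
    · rintro ⟨d, hd, rfl⟩
      have hmem : ∀ j : (S.erase i : Finset ι), (j : ι) ∈ S := fun j =>
        Finset.mem_of_mem_erase j.2
      refine ⟨fun j => d ⟨j, hmem j⟩ + d i * c ⟨j, hmem j⟩, fun j =>
        add_nonneg (hd _) (mul_nonneg (hd _) (hc _)), ?_⟩
      have key : ∀ g : S → E, g i = 0 → ∑ j, g j = ∑ j : (S.erase i : Finset ι), g ⟨j, hmem j⟩ := by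
        intro g hg
        have h1 := Finset.sum_coe_sort (S.erase i) fun j => if h : j ∈ S then g ⟨j, h⟩ else 0
        have h2 := Finset.sum_coe_sort S fun j => if h : j ∈ S then g ⟨j, h⟩ else 0
        rw [Finset.sum_erase S (by simp [hg]), ← h2] at h1
        calc ∑ j, g j = ∑ j : S, if h : (j : ι) ∈ S then g ⟨j, h⟩ else 0 :=
              Finset.sum_congr rfl fun j _ => by simp
          _ = _ := h1.symm
          _ = _ := Finset.sum_congr rfl fun j _ => by simp [hmem j]
      have h3 : ∑ j, d j • a j = ∑ j : S, ((if j = i then 0 else d j) + d i * c j) • a j := by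
        have h4 : ∑ j : S, (if j = i then d i else 0) • a j = d i • a i := by
          simp [ite_smul]
        have h5 : d i • a i = ∑ j : S, (d i * c j) • a j := by
          rw [hai, Finset.smul_sum]; simp [smul_smul]
        simp only [add_smul, Finset.sum_add_distrib]
        rw [← h5, ← h4, ← Finset.sum_add_distrib]
        refine Finset.sum_congr rfl fun j _ => ?_
        by_cases h : j = i
        · subst h; simp
        · simp [h]
      rw [h3, key _ (by simp [hci])]
      refine Finset.sum_congr rfl fun j _ => ?_
      have : (⟨j, hmem j⟩ : S) ≠ i := fun h => (Finset.ne_of_mem_erase j.2) (congrArg Subtype.val h)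
      simp [this]
  exact (Finset.notMem_erase (i : ι) S) (hmin hP (Finset.erase_subset _ _) i.2)

/-- The vectors of a minimal system of generators span extreme rays. -/
theorem genCone_extreme (hβ : ∀ j, 0 < β (a j))
    (hmin : ∀ i, ∀ c : ι → ℝ, (∀ j, 0 ≤ c j) → c i = 0 → a i ≠ ∑ j, c j • a j)
    (i : ι) {x y : E} {l : ℝ} (hx : x ∈ genCone a) (hy : y ∈ genCone a) (h : x + y = l • a i) :
    ∃ s : ℝ, 0 ≤ s ∧ x = s • a i := by
  classical
  obtain ⟨c, hc, rfl⟩ := hx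
  obtain ⟨d, hd, rfl⟩ := hy
  set e : ι → ℝ := fun j => if j = i then 0 else c j + d j with he
  have he0 : ∀ j, 0 ≤ e j := fun j => by
    simp only [he]; split_ifs
    · exact le_rfl
    · exact add_nonneg (hc j) (hd j)
  have hsum : ∑ j, e j • a j = (l - c i - d i) • a i := by
    rw [sub_sub, sub_smul, ← h, ← Finset.sum_add_distrib]
    have h4 : ∑ j, (if j = i then c i + d i else 0) • a j = (c i + d i) • a i := by
      simp [ite_smul]
    rw [← h4, eq_sub_iff_add_eq, ← Finset.sum_add_distrib]
    refine Finset.sum_congr rfl fun j _ => ?_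
    by_cases h : j = i
    · subst h; simp [he, add_smul]
    · simp [he, h, add_smul]
  -- A positive factor would express `a i` through the other generators, against minimality.
  -- Otherwise `β` forces every coefficient away from `i` to vanish.
  rcases lt_or_ge 0 (l - c i - d i) with hl | hl
  · exfalso
    refine hmin i (fun j => e j / (l - c i - d i)) (fun j => div_nonneg (he0 j) hl.le)
      (by simp [he]) ?_
    have := congrArg (fun x => (l - c i - d i)⁻¹ • x) hsum
    simp only [Finset.smul_sum, smul_smul, inv_mul_cancel₀ hl.ne', one_smul] at this
    rw [← this]
    exact Finset.sum_congr rfl fun j _ => by rw [div_eq_inv_mul]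
  · have h1 : ∑ j, e j * β (a j) = (l - c i - d i) * β (a i) := by
      have := congrArg β hsum
      simpa only [map_sum, map_smul, smul_eq_mul] using this
    have h2 : ∀ j ∈ Finset.univ, 0 ≤ e j * β (a j) := fun j _ => mul_nonneg (he0 j) (hβ j).le
    have h3 := (Finset.sum_eq_zero_iff_of_nonneg h2).1 (le_antisymm
      (by rw [h1]; exact mul_nonpos_of_nonpos_of_nonneg hl (hβ i).le) (Finset.sum_nonneg h2))
    refine ⟨c i, hc i, Finset.sum_eq_single i (fun j hj hji => ?_) (by simp)⟩
    have h4 := (mul_eq_zero.1 (h3 j hj)).resolve_right (hβ j).ne'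
    simp only [he, hji, if_false] at h4
    have : c j = 0 := le_antisymm (by linarith [hd j]) (hc j)
    simp [this]

/-- If the sets `C + ℝ b i` meet pairwise only in `C`, then the generators are independent. -/
theorem linearIndependent_of_genCone (hβ : ∀ j, 0 < β (a j))
    (hpair : ∀ i j, i ≠ j → ∀ y : E, ∀ M M' : ℝ, y + M • a i ∈ genCone a →
      y + M' • a j ∈ genCone a → y ∈ genCone a) :
    LinearIndependent ℝ a := by
  classical
  -- Induction on the number of positive coefficients of a linear relation.
  have key : ∀ n : ℕ, ∀ c : ι → ℝ, ∑ j, c j • a j = 0 →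
      (Finset.univ.filter fun j => 0 < c j).card ≤ n → ∀ j, c j = 0 := by
    intro n
    induction n with
    | zero =>
      intro c hc hn j
      have hle : ∀ j, c j ≤ 0 := fun j => by
        by_contra h
        have : j ∈ Finset.univ.filter fun j => 0 < c j := by simpa using h
        rw [Finset.card_eq_zero.1 (Nat.le_zero.1 hn)] at this
        simp at this
      have h1 := congrArg β hc
      simp only [map_sum, map_smul, smul_eq_mul, map_zero] at h1
      have h2 := (Finset.sum_eq_zero_iff_of_nonpos fun j _ =>
        mul_nonpos_of_nonpos_of_nonneg (hle j) (hβ j).le).1 h1 j (Finset.mem_univ j)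
      exact (mul_eq_zero.1 h2).resolve_right (hβ j).ne'
    | succ n ih =>
      intro c hc hn
      have h1 := congrArg β hc
      simp only [map_sum, map_smul, smul_eq_mul, map_zero] at h1
      by_cases hpos : ∃ i, 0 < c i
      swap
      · refine ih c hc ?_
        rw [Finset.filter_false_of_mem fun j _ => fun h => hpos ⟨j, h⟩]
        simp
      obtain ⟨i, hi⟩ := hpos
      obtain ⟨k, hk⟩ : ∃ k, c k < 0 := by
        by_contra h
        push Not at h
        have := (Finset.sum_eq_zero_iff_of_nonneg fun j _ =>
          mul_nonneg (h j) (hβ j).le).1 h1 i (Finset.mem_univ i)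
        exact (mul_pos hi (hβ i)).ne' this
      have hik : i ≠ k := by rintro rfl; linarith
      set p : ι → ℝ := fun j => if 0 < c j ∧ j ≠ i then c j else 0 with hp
      set q : ι → ℝ := fun j => if ¬ 0 < c j ∧ j ≠ k then -c j else 0 with hq
      have hsk : ∀ (k : ι) (r : ℝ), ∑ j, (if j = k then r else 0) • a j = r • a k := by
        intro k r; simp [ite_smul]
      -- This vector keeps the positive terms except `i` and adds the negative term `k`. Adding `c i
      -- • a i` turns it, by the relation, into minus the remaining negative terms; removing the
      -- term `k` leaves only positive terms. Both are in the cone, so `hpair` applies.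
      have hy : ∑ j, p j • a j + c k • a k ∈ genCone a := by
        refine hpair i k hik _ (c i) (-c k) ?_ ?_
        · refine ⟨q, fun j => ?_, ?_⟩
          · simp only [hq]; split_ifs with h
            · linarith [not_lt.1 h.1]
            · exact le_rfl
          · rw [← hsk k, ← hsk i, ← sub_eq_zero, ← Finset.sum_add_distrib,
              ← Finset.sum_add_distrib, ← Finset.sum_sub_distrib, ← hc]
            refine Finset.sum_congr rfl fun j _ => ?_
            rw [← add_smul, ← add_smul, ← sub_smul]
            congr 1
            simp only [hp, hq]
            by_cases hji : j = i
            · subst hji; simp [hi, hik]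
            · by_cases hjk : j = k
              · subst hjk; simp [hji, hk.not_gt]
              · by_cases hj : 0 < c j <;> simp [hji, hjk, hj]
        · refine ⟨p, fun j => ?_, by simp⟩
          simp only [hp]; split_ifs with h
          · exact h.1.le
          · exact le_rfl
      obtain ⟨e, he, hye⟩ := hy
      -- The new relation is no longer positive at `i` and gains no positive coefficient, yet its
      -- coefficient at `k` is at most `c k < 0`.
      set c' : ι → ℝ := fun j => p j + (if j = k then c k else 0) - e j with hc'
      have hc'0 : ∑ j, c' j • a j = 0 := by
        simp only [hc', sub_smul, add_smul, Finset.sum_sub_distrib, Finset.sum_add_distrib]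
        rw [hsk, hye, sub_self]
      have hcard : (Finset.univ.filter fun j => 0 < c' j).card ≤ n := by
        refine Nat.lt_succ_iff.1 (lt_of_lt_of_le (Finset.card_lt_card ?_) hn)
        rw [Finset.ssubset_iff_of_subset]
        · refine ⟨i, by simpa using hi, ?_⟩
          simp [hc', hp, hik, he i]
        · intro j hj
          simp only [Finset.mem_filter, Finset.mem_univ, true_and] at hj ⊢
          by_contra hcj
          have h3 : p j = 0 := by simp [hp, hcj]
          simp only [hc', h3, zero_add] at hj
          have := he j
          split_ifs at hj <;> linarith
      have := ih c' hc'0 hcard k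
      have h3 : p k = 0 := by simp [hp, hk.not_gt]
      simp only [hc', h3, if_true] at this
      linarith [he k]
  rw [Fintype.linearIndependent_iff]
  exact fun c hc => key _ c hc le_rfl

end GenCone

/-! ### Local tilings of a pointed cone -/

/-- `T + J` is a local tiling, near the apex, of the cone generated by `a`: every translate lies in
the cone, and the part of the cone where `β < ρ` is covered, while `β < δ` on `T`. -/
structure IsLocalConeTiling {E ι : Type*} [NormedAddCommGroup E] [NormedSpace ℝ E] [Fintype ι]
    (a : ι → E) (β : E →L[ℝ] ℝ) (T J : Set E) (δ ρ : ℝ) : Prop where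
  pos : ∀ j, 0 < β (a j)
  finite : J.Finite
  isCompact : IsCompact T
  regular : T ⊆ closure (interior T)
  zero_mem : (0 : E) ∈ T
  subset : ∀ x ∈ T, x ∈ genCone a
  lt : ∀ x ∈ T, β x < δ
  lt' : δ < ρ
  translate_subset : ∀ t ∈ J, ∀ x ∈ T, x + t ∈ genCone a
  covering : ∀ x ∈ genCone a, β x < ρ → ∃ t ∈ J, x - t ∈ T
  disjoint : ∀ t ∈ J, ∀ t' ∈ J, ∀ x, x - t ∈ interior T → x - t' ∈ T → t = t'

namespace IsLocalConeTiling

open Filter Topology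

variable {E ι : Type*} [NormedAddCommGroup E] [NormedSpace ℝ E] [Fintype ι]
  {a : ι → E} {β : E →L[ℝ] ℝ} {T J : Set E} {δ ρ : ℝ}

theorem delta_pos (h : IsLocalConeTiling a β T J δ ρ) : 0 < δ := by
  simpa using h.lt 0 h.zero_mem

theorem translation_mem (h : IsLocalConeTiling a β T J δ ρ) {t : E} (ht : t ∈ J) :
    t ∈ genCone a := by
  simpa using h.translate_subset t ht 0 h.zero_mem

theorem eq_zero_of_neg_mem (h : IsLocalConeTiling a β T J δ ρ) {t : E} (ht : t ∈ genCone a)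
    (ht' : -t ∈ genCone a) : t = 0 := by
  refine genCone_eq_zero (β := (β : E →ₗ[ℝ] ℝ)) h.pos ht ?_
  have := genCone_nonneg (β := (β : E →ₗ[ℝ] ℝ)) h.pos ht'
  simpa using this

/-- If a translate by `t` covers the apex, then `t` and `-t` both lie in the pointed cone, so `t =
0`. -/
theorem zero_translation_mem (h : IsLocalConeTiling a β T J δ ρ) : (0 : E) ∈ J := by
  obtain ⟨t, ht, htT⟩ := h.covering 0 genCone_zero_mem (by simpa using h.delta_pos.trans h.lt')
  rw [zero_sub] at htT
  rwa [← h.eq_zero_of_neg_mem (h.translation_mem ht) (h.subset _ htT)]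

/-- Near a point `p`, only the tiles that contain `p` matter. -/
theorem eventually_covering (h : IsLocalConeTiling a β T J δ ρ) {p : E} (hp : β p < ρ) :
    ∀ᶠ x in 𝓝 p, x ∈ genCone a → ∃ t ∈ J, x - t ∈ T ∧ p - t ∈ T := by
  have h1 : ∀ᶠ x in 𝓝 p, ∀ t ∈ J, p - t ∉ T → x - t ∉ T := by
    rw [eventually_all_finite h.finite]
    intro t _
    by_cases hpt : p - t ∈ T
    · exact Eventually.of_forall fun x hx => absurd hpt hx
    · have hc : ContinuousAt (fun x : E => x - t) p := by fun_prop
      filter_upwards [hc.eventually (h.isCompact.isClosed.isOpen_compl.mem_nhds hpt)] with x hx _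
        using hx
  have h2 : ∀ᶠ x in 𝓝 p, β x < ρ := β.continuous.continuousAt.eventually (gt_mem_nhds hp)
  filter_upwards [h1, h2] with x hx1 hx2 hxC
  obtain ⟨t, ht, hxt⟩ := h.covering x hxC hx2
  exact ⟨t, ht, hxt, by_contra fun hpt => hx1 t ht hpt hxt⟩

theorem eventually_zero (h : IsLocalConeTiling a β T J δ ρ) :
    ∀ᶠ x in 𝓝 (0 : E), x ∈ genCone a → x ∈ T := by
  filter_upwards [h.eventually_covering (p := 0) (by simpa using h.delta_pos.trans h.lt')]
    with x hx hxC
  obtain ⟨t, ht, hxt, h0t⟩ := hx hxC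
  rw [zero_sub] at h0t
  have := h.eq_zero_of_neg_mem (h.translation_mem ht) (h.subset _ h0t)
  simpa [this] using hxt

/-- Below height `ρ` the cone is covered by finitely many compact translates contained in it;
scaling carries closedness to all heights. -/
theorem isClosed_genCone (h : IsLocalConeTiling a β T J δ ρ) : IsClosed (genCone a) := by
  refine isClosed_of_closure_subset fun x hx => ?_
  have hρ : 0 < ρ := h.delta_pos.trans h.lt'
  have hsub : closure (genCone a ∩ {x | β x < ρ}) ⊆ genCone a := by
    have hcl : IsClosed (⋃ t ∈ J, (fun x : E => x + t) '' T) :=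
      h.finite.isClosed_biUnion fun t _ =>
        (h.isCompact.image (by fun_prop : Continuous fun x : E => x + t)).isClosed
    refine (closure_minimal ?_ hcl).trans ?_
    · rintro y ⟨hy, hyρ⟩
      obtain ⟨t, ht, hyt⟩ := h.covering y hy hyρ
      exact Set.mem_biUnion ht ⟨y - t, hyt, by simp⟩
    · intro y hy
      obtain ⟨t, ht, z, hz, rfl⟩ := Set.mem_iUnion₂.1 hy
      exact h.translate_subset t ht z hz
  obtain ⟨s, hs, hsx⟩ : ∃ s : ℝ, 0 < s ∧ β (s • x) < ρ := by
    have hc : Tendsto (fun s : ℝ => β (s • x)) (𝓝[>] 0) (𝓝 0) := by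
      have : Continuous fun s : ℝ => β (s • x) := by fun_prop
      simpa using (this.tendsto 0).mono_left nhdsWithin_le_nhds
    obtain ⟨s, h1, h2⟩ := ((hc.eventually (gt_mem_nhds hρ)).and self_mem_nhdsWithin).exists
    exact ⟨s, h2, h1⟩
  have h1 : s • x ∈ closure (genCone a) :=
    map_mem_closure (continuous_const_smul s) hx fun y hy => genCone_smul_mem hs.le hy
  have hopen : IsOpen {x | β x < ρ} := isOpen_lt β.continuous continuous_const
  have h2 : s • x ∈ closure (genCone a ∩ {x | β x < ρ}) := by
    have := hopen.inter_closure ⟨hsx, h1⟩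
    rwa [Set.inter_comm] at this
  have := genCone_smul_mem (inv_nonneg.2 hs.le) (hsub h2)
  rwa [smul_smul, inv_mul_cancel₀ hs.ne', one_smul] at this

/-- Along each extreme ray there is a first non-zero translation vector. -/
theorem exists_first (h : IsLocalConeTiling a β T J δ ρ)
    (hext : ∀ i x y (l : ℝ), x ∈ genCone a → y ∈ genCone a → x + y = l • a i →
      ∃ s : ℝ, 0 ≤ s ∧ x = s • a i) (i : ι) :
    ∃ s : ℝ, 0 < s ∧ s • a i ∈ J ∧ β (s • a i) ≤ δ ∧ ∀ s', 0 < s' → s' < s → s' • a i ∉ J := by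
  have hinj : Function.Injective fun s : ℝ => s • a i := by
    intro s s' hs
    have := congrArg β hs
    simp only [map_smul, smul_eq_mul] at this
    exact mul_right_cancel₀ (h.pos i).ne' this
  have hfin : {s : ℝ | 0 < s ∧ s • a i ∈ J}.Finite :=
    (h.finite.preimage hinj.injOn).subset fun s hs => hs.2
  obtain ⟨s0, hs0, hs0J, hs0δ⟩ : ∃ s : ℝ, 0 < s ∧ s • a i ∈ J ∧ β (s • a i) ≤ δ := by
    -- The point of the ray at height `δ` is too high for `T`, so a translate by a nonzero `t`
    -- covers it; extremality puts `t` on the ray.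
    set l := δ / β (a i) with hl
    have hl0 : 0 < l := div_pos h.delta_pos (h.pos i)
    have hβl : β (l • a i) = δ := by
      simp [hl, div_mul_cancel₀ _ (h.pos i).ne']
    obtain ⟨t, ht, htT⟩ := h.covering (l • a i) (genCone_smul_mem hl0.le (genCone_self_mem i))
      (by rw [hβl]; exact h.lt')
    obtain ⟨s, hs, rfl⟩ := hext i t _ l (h.translation_mem ht) (h.subset _ htT) (by abel)
    refine ⟨s, lt_of_le_of_ne hs ?_, ht, ?_⟩
    · rintro rfl
      have := h.lt _ htT
      simp only [zero_smul, sub_zero, hβl, lt_irrefl] at this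
    · have := genCone_nonneg (β := (β : E →ₗ[ℝ] ℝ)) h.pos (h.subset _ htT)
      simp only [ContinuousLinearMap.coe_coe, map_sub, sub_nonneg] at this
      exact this.trans hβl.le
  obtain ⟨s, ⟨hs, hsJ⟩, hmin⟩ := Set.exists_min_image _ id hfin ⟨s0, hs0, hs0J⟩
  refine ⟨s, hs, hsJ, le_trans ?_ hs0δ, fun s' hs' hlt hJ => ?_⟩
  · have := hmin s0 ⟨hs0, hs0J⟩
    simp only [map_smul, smul_eq_mul]
    exact mul_le_mul_of_nonneg_right this (h.pos i).le
  · exact (hmin s' ⟨hs', hJ⟩).not_gt hlt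

/-- The germ of the tile at the first translation vector along an extreme ray. -/
theorem eventually_first (h : IsLocalConeTiling a β T J δ ρ)
    (hext : ∀ i x y (l : ℝ), x ∈ genCone a → y ∈ genCone a → x + y = l • a i →
      ∃ s : ℝ, 0 ≤ s ∧ x = s • a i) (i : ι) (hδ : β (a i) ≤ δ)
    (hfirst : ∀ s : ℝ, 0 < s → s < 1 → s • a i ∉ J) :
    ∀ᶠ x in 𝓝 (a i), x ∈ genCone a → x - a i ∉ genCone a → x ∈ T := by
  filter_upwards [h.eventually_covering (hδ.trans_lt h.lt')] with x hx hxC hxC'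
  obtain ⟨t, ht, hxt, hat⟩ := hx hxC
  obtain ⟨s, hs, rfl⟩ := hext i t (a i - t) 1 (h.translation_mem ht) (h.subset _ hat) (by simp)
  rcases hs.eq_or_lt with rfl | hs0
  · simpa using hxt
  · have hs1 : ¬ s < 1 := fun hs1 => hfirst s hs0 hs1 ht
    have hs1' : s ≤ 1 := by
      have := genCone_nonneg (β := (β : E →ₗ[ℝ] ℝ)) h.pos (h.subset _ hat)
      simp only [ContinuousLinearMap.coe_coe, map_sub, sub_nonneg, map_smul, smul_eq_mul] at this
      by_contra hlt
      nlinarith [h.pos i]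
    have : s = 1 := le_antisymm hs1' (not_lt.1 hs1)
    subst this
    exact absurd (h.subset _ (by simpa using hxt)) hxC'

/-- The pairwise condition that forces the cone to be simplicial. -/
theorem mem_genCone_of_pair (h : IsLocalConeTiling a β T J δ ρ)
    (hJ : ∀ i, a i ∈ J)
    (hgerm : ∀ i, ∀ᶠ x in 𝓝 (a i), x ∈ genCone a → x - a i ∉ genCone a → x ∈ T)
    {i j : ι} (hij : a i ≠ a j) (hne : (interior T).Nonempty) {y : E} {M M' : ℝ}
    (hi : y + M • a i ∈ genCone a) (hj : y + M' • a j ∈ genCone a) : y ∈ genCone a := by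
  by_contra hy
  obtain ⟨v, hv⟩ := hne
  have hvC : ∀ᶠ x in 𝓝 v, x ∈ genCone a := by
    filter_upwards [mem_interior_iff_mem_nhds.1 hv] with x hx using h.subset x hx
  -- perturb `y` into an open set of counterexamples
  obtain ⟨y', hy'⟩ : ∃ y', ∀ᶠ z in 𝓝 y', z ∉ genCone a ∧ z + M • a i ∈ genCone a ∧
      z + M' • a j ∈ genCone a := by
    have hc : Tendsto (fun η : ℝ => y + η • v) (𝓝[>] 0) (𝓝 y) := by
      have : Continuous fun η : ℝ => y + η • v := by fun_prop
      simpa using (this.tendsto 0).mono_left nhdsWithin_le_nhds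
    obtain ⟨η, hη1, hη⟩ := ((hc.eventually (h.isClosed_genCone.isOpen_compl.mem_nhds hy)).and
      self_mem_nhdsWithin).exists
    have hη : 0 < η := hη
    refine ⟨y + η • v, ?_⟩
    have hc2 : ContinuousAt (fun z : E => η⁻¹ • (z - y)) (y + η • v) := by fun_prop
    have hc3 : ∀ᶠ z in 𝓝 (y + η • v), η⁻¹ • (z - y) ∈ genCone a := by
      refine hc2.eventually ?_
      simpa [smul_smul, inv_mul_cancel₀ hη.ne'] using hvC
    filter_upwards [hc3, h.isClosed_genCone.isOpen_compl.mem_nhds hη1] with z hz hzC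
    have hz' : z - y ∈ genCone a := by
      have := genCone_smul_mem hη.le hz
      rwa [smul_smul, mul_inv_cancel₀ hη.ne', one_smul] at this
    refine ⟨hzC, ?_, ?_⟩
    · convert genCone_add_mem hi hz' using 1; abel
    · convert genCone_add_mem hj hz' using 1; abel
  have key : ∀ (k : ι) (N : ℝ) (z : E) (ε : ℝ), 0 < ε → ε * N < 1 → z + N • a k ∈ genCone a →
      a k + ε • z ∈ genCone a := by
    intro k N z ε hε hεN hz
    have := genCone_add_mem (genCone_smul_mem hε.le hz)
      (genCone_smul_mem (sub_nonneg.2 hεN.le) (genCone_self_mem (a := a) k))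
    convert this using 1
    rw [smul_add, smul_smul, sub_smul, one_smul]; abel
  have hlim : ∀ k, Tendsto (fun ε : ℝ => a k + ε • y') (𝓝[>] 0) (𝓝 (a k)) := fun k => by
    have : Continuous fun ε : ℝ => a k + ε • y' := by fun_prop
    simpa using (this.tendsto 0).mono_left nhdsWithin_le_nhds
  have hlt : ∀ N : ℝ, ∀ᶠ ε : ℝ in 𝓝[>] 0, ε * N < 1 := fun N => by
    have : Continuous fun ε : ℝ => ε * N := by fun_prop
    have h2 : Tendsto (fun ε : ℝ => ε * N) (𝓝[>] 0) (𝓝 0) := by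
      simpa using (this.tendsto 0).mono_left nhdsWithin_le_nhds
    exact h2.eventually (gt_mem_nhds one_pos)
  obtain ⟨ε, h1, h2, h3, h4, hε⟩ := (((hlim i).eventually (hgerm i)).and
    (((hlim j).eventually (hgerm j).eventually_nhds).and
    ((hlt M).and ((hlt M').and self_mem_nhdsWithin)))).exists
  have hε : 0 < ε := hε
  have hnot : ∀ z, z ∉ genCone a → ε • z ∉ genCone a := fun z hz hεz => hz (by
    have := genCone_smul_mem (inv_nonneg.2 hε.le) hεz
    rwa [smul_smul, inv_mul_cancel₀ hε.ne', one_smul] at this)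
  obtain ⟨hy1, hy2, hy3⟩ := hy'.self_of_nhds
  -- `a i + ε • y'` is in the cone because it equals `ε • (y' + M • a i) + (1 - ε * M) • a i`, and
  -- it is not in `a i + genCone a` because `y'` is not in the cone; the germ at `a i` then puts it
  -- in `T`.
  have hTi : a i + ε • y' ∈ T := h1 (key i M y' ε hε h3 hy2) (by simpa using hnot y' hy1)
  have hTj : a j + ε • y' ∈ interior T := by
    rw [mem_interior_iff_mem_nhds]
    have hc : ContinuousAt (fun x : E => ε⁻¹ • (x - a j)) (a j + ε • y') := by fun_prop
    have hc2 : ∀ᶠ x in 𝓝 (a j + ε • y'), ε⁻¹ • (x - a j) ∉ genCone a ∧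
        ε⁻¹ • (x - a j) + M • a i ∈ genCone a ∧ ε⁻¹ • (x - a j) + M' • a j ∈ genCone a := by
      refine hc.eventually (p := fun z => z ∉ genCone a ∧ z + M • a i ∈ genCone a ∧
        z + M' • a j ∈ genCone a) ?_
      simpa [smul_smul, inv_mul_cancel₀ hε.ne'] using hy'
    filter_upwards [h2, hc2] with x hx hx2
    have hxe : x = a j + ε • (ε⁻¹ • (x - a j)) := by
      rw [smul_smul, mul_inv_cancel₀ hε.ne', one_smul]; abel
    refine hx ?_ ?_
    · rw [hxe]; exact key j M' _ ε hε h4 hx2.2.2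
    · have := hnot _ hx2.1
      rwa [smul_smul, mul_inv_cancel₀ hε.ne', one_smul] at this
  refine hij (h.disjoint _ (hJ i) _ (hJ j) (a i + a j + ε • y') ?_ ?_)
  · convert hTj using 1; abel
  · convert hTi using 1; abel

/-- A local tiling of a cone by a small tile, whose generators are the first translation vectors
along extreme rays: the generators form a basis in which the tile is a union of unit cells. -/
theorem exists_basis_of_first [FiniteDimensional ℝ E] [DecidableEq ι]
    (h : IsLocalConeTiling a β T J δ ρ)
    (hρ : (Fintype.card ι + 1) * δ < ρ) (ha : Function.Injective a)
    (hext : ∀ i x y (l : ℝ), x ∈ genCone a → y ∈ genCone a → x + y = l • a i →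
      ∃ s : ℝ, 0 ≤ s ∧ x = s • a i) (hJ : ∀ i, a i ∈ J) (hδ : ∀ i, β (a i) ≤ δ)
    (hfirst : ∀ i, ∀ s : ℝ, 0 < s → s < 1 → s • a i ∉ J) :
    ∃ (b : Module.Basis ι ℝ E) (K : Finset (ι → ℕ)), 0 ∈ K ∧
      T = {x | ∃ k ∈ K, ∀ i, (k i : ℝ) ≤ b.repr x i ∧ b.repr x i ≤ (k i : ℝ) + 1} := by
  have hne : (interior T).Nonempty := by
    have := h.regular h.zero_mem
    exact closure_nonempty_iff.1 ⟨_, this⟩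
  have hgerm := fun i => h.eventually_first hext i (hδ i) (hfirst i)
  have hli : LinearIndependent ℝ a :=
    linearIndependent_of_genCone (β := (β : E →ₗ[ℝ] ℝ)) h.pos fun i j hij y M M' hi hj =>
      h.mem_genCone_of_pair hJ hgerm (ha.ne hij) hne hi hj
  have hspan : ⊤ ≤ Submodule.span ℝ (Set.range a) := by
    refine (Submodule.eq_top_of_nonempty_interior' _ (hne.mono (interior_mono fun x hx => ?_))).ge
    obtain ⟨c, -, rfl⟩ := h.subset x hx
    exact Submodule.sum_mem _ fun j _ =>
      Submodule.smul_mem _ _ (Submodule.subset_span ⟨j, rfl⟩)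
  set b : Module.Basis ι ℝ E := Module.Basis.mk hli hspan with hb
  set L : (ι → ℝ) ≃L[ℝ] E := b.equivFunL.symm with hL
  have hLx : ∀ x, L x = ∑ i, x i • a i := fun x => by
    have : L x = ∑ i, x i • b i := b.equivFun_symm_apply x
    rw [this]; simp [hb]
  have hLC : ∀ x, L x ∈ genCone a ↔ 0 ≤ x := by
    intro x
    constructor
    · rintro ⟨c, hc, hxc⟩
      rw [← hLx] at hxc
      rw [L.injective hxc]
      exact hc
    · intro hx
      exact ⟨x, hx, hLx x⟩
  have hLe : ∀ i, L (Pi.single i 1) = a i := fun i => by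
    rw [hLx]; simp [Pi.single_apply, ite_smul]
  have hint : interior (L ⁻¹' T) = L ⁻¹' interior T :=
    (L.toHomeomorph.preimage_interior T).symm
  have hclo : closure (L ⁻¹' interior T) = L ⁻¹' closure (interior T) :=
    (L.toHomeomorph.preimage_closure _).symm
  have hcomp : IsCompact (L ⁻¹' T) := L.toHomeomorph.isCompact_preimage.2 h.isCompact
  obtain ⟨K, hK0, hK⟩ := exists_eq_union_cells (T := L ⁻¹' T) (J := L ⁻¹' J)
    (h.finite.preimage L.injective.injOn) hcomp
    (by rw [hint, hclo]; exact Set.preimage_mono h.regular)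
    (fun x hx => (hLC x).1 (h.subset _ hx))
    (by
      have h1 : Tendsto L (𝓝 0) (𝓝 0) := by simpa using L.continuous.tendsto 0
      filter_upwards [h1.eventually h.eventually_zero] with x hx hx0
      exact hx ((hLC x).2 hx0))
    (fun t ht => (hLC t).1 (h.translation_mem ht))
    (by simpa using h.zero_translation_mem)
    (fun i => by rw [Set.mem_preimage, hLe]; exact hJ i)
    (fun i => by
      have h1 : Tendsto L (𝓝 (Pi.single i 1)) (𝓝 (a i)) := by
        simpa [hLe] using L.continuous.tendsto (Pi.single i 1)
      filter_upwards [h1.eventually (hgerm i)] with x hx hx0 hxi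
      refine hx ((hLC x).2 hx0) fun hC => ?_
      rw [← hLe, ← map_sub, hLC] at hC
      have := hC i
      simp at this
      linarith)
    (fun x hx z hz hxz => by
      obtain ⟨t, ht, hxt⟩ := h.covering (L x) ((hLC x).2 hx) (by
        -- Here `x ≤ z + 1` costs height less than `δ` for `z` and at most `δ` for each generator,
        -- which explains the factor `card ι + 1`.
        refine lt_of_le_of_lt ?_ hρ
        have h1 : β (L x) ≤ β (L (z + 1)) := by
          rw [hLx, hLx]
          simp only [map_sum, map_smul, smul_eq_mul]
          exact Finset.sum_le_sum fun i _ => mul_le_mul_of_nonneg_right (hxz i) (h.pos i).le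
        have h2 : β (L 1) ≤ Fintype.card ι * δ := by
          rw [hLx]
          simp only [map_sum, map_smul, smul_eq_mul, Pi.one_apply, one_mul]
          calc ∑ i, β (a i) ≤ ∑ _i : ι, δ := Finset.sum_le_sum fun i _ => hδ i
            _ = _ := by simp
        rw [map_add, map_add] at h1
        have h3 := h.lt _ hz
        linarith)
      refine ⟨L.symm t, by simpa using ht, ?_⟩
      simpa using hxt)
    (fun t ht t' ht' x hx hx' => by
      refine L.injective (h.disjoint _ ht _ ht' (L x) ?_ ?_)
      · rw [hint, Set.mem_preimage, map_sub] at hx; exact hx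
      · rw [Set.mem_preimage, map_sub] at hx'; exact hx')
  refine ⟨b, K, hK0, ?_⟩
  ext x
  have h1 : x ∈ T ↔ L.symm x ∈ L ⁻¹' T := by simp
  rw [h1, hK]
  rfl

/-- A small regular compact set that tiles a polyhedral cone locally is, in suitable coordinates, a
union of unit cells. -/
theorem exists_basis [FiniteDimensional ℝ E] (h : IsLocalConeTiling a β T J δ ρ)
    (hρ : (Fintype.card ι + 1) * δ < ρ) :
    ∃ (n : ℕ) (b : Module.Basis (Fin n) ℝ E) (K : Finset (Fin n → ℕ)), 0 ∈ K ∧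
      T = {x | ∃ k ∈ K, ∀ i, (k i : ℝ) ≤ b.repr x i ∧ b.repr x i ≤ (k i : ℝ) + 1} := by
  classical
  obtain ⟨S, hS, hmin⟩ := exists_minimal_generators a
  have hS1 : IsLocalConeTiling (fun j : S => a j) β T J δ ρ :=
    { h with
      pos := fun j => h.pos j
      subset := hS ▸ h.subset
      translate_subset := hS ▸ h.translate_subset
      covering := hS ▸ h.covering }
  have hext := genCone_extreme (a := fun j : S => a j) (β := (β : E →ₗ[ℝ] ℝ)) hS1.pos hmin
  -- Positive rescaling makes each generator the first translation vector on its ray without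
  -- changing the cone.
  choose s hs hsJ hsδ hsmin using hS1.exists_first fun i x y l => hext i
  have hcone := genCone_smul_eq (a := fun j : S => a j) hs
  have hS2 : IsLocalConeTiling (fun j : S => s j • a j) β T J δ ρ :=
    { h with
      pos := fun j => by simpa using mul_pos (hs j) (h.pos j)
      subset := hcone ▸ hS1.subset
      translate_subset := hcone ▸ hS1.translate_subset
      covering := hcone ▸ hS1.covering }
  have hcard : ((Fintype.card S : ℝ) + 1) * δ < ρ := by
    refine lt_of_le_of_lt ?_ hρ
    have h1 : (Fintype.card S : ℝ) ≤ Fintype.card ι := by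
      exact_mod_cast Fintype.card_le_of_injective (Subtype.val : S → ι) Subtype.val_injective
    nlinarith [h.delta_pos]
  obtain ⟨b, K, hK0, hK⟩ := hS2.exists_basis_of_first hcard
    (by
      intro i j hij
      by_contra hne
      have hij : s i • a i = s j • a j := hij
      refine hmin i (Pi.single j ((s i)⁻¹ * s j)) (fun k => ?_)
        (by rw [Pi.single_eq_of_ne hne]) ?_
      · by_cases hk : k = j
        · subst hk; simpa using mul_nonneg (inv_nonneg.2 (hs i).le) (hs k).le
        · simp [hk]
      · have h1 : a i = ((s i)⁻¹ * s j) • a j := by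
          rw [mul_smul, ← hij, smul_smul, inv_mul_cancel₀ (hs i).ne', one_smul]
        rw [Finset.sum_eq_single j (fun k _ hk => by simp [hk]) (by simp)]
        simpa using h1)
    (by
      intro i x y l hx hy hxy
      rw [hcone] at hx hy
      rw [smul_smul] at hxy
      obtain ⟨r, hr, rfl⟩ := hext i hx hy hxy
      refine ⟨r / s i, div_nonneg hr (hs i).le, ?_⟩
      rw [smul_smul, div_mul_cancel₀ _ (hs i).ne'])
    hsJ hsδ
    (by
      intro i r hr hr1
      rw [smul_smul]
      exact hsmin i _ (mul_pos hr (hs i)) (by nlinarith [hs i]))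
  let e : S ≃ Fin (Fintype.card S) := Fintype.equivFin S
  refine ⟨_, b.reindex e, K.image fun k i => k (e.symm i), ?_, ?_⟩
  · exact Finset.mem_image.2 ⟨0, hK0, rfl⟩
  · rw [hK]
    ext x
    constructor
    · rintro ⟨k, hk, hx⟩
      exact ⟨_, Finset.mem_image_of_mem _ hk, fun i => by simpa using hx (e.symm i)⟩
    · rintro ⟨k, hk, hx⟩
      obtain ⟨k, hk', rfl⟩ := Finset.mem_image.1 hk
      exact ⟨k, hk', fun i => by simpa using hx (e i)⟩

end IsLocalConeTiling

/-! ### Volume counting and subdivision of expanding tiles -/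

open MeasureTheory in
/-- If finitely many translates of a set of finite measure cover a set of the largest possible
measure, they overlap in null sets. -/
theorem measure_inter_translates_eq_zero {E : Type*} [AddCommGroup E] [TopologicalSpace E]
    [IsTopologicalAddGroup E] [MeasurableSpace E] [BorelSpace E] {μ : Measure E}
    [μ.IsAddLeftInvariant] {T : Set E} (hT : IsClosed T)
    (hfin : μ T ≠ ⊤) {F : Finset E} (hF : F.card * μ T ≤ μ (T + (F : Set E))) {t t' : E}
    (ht : t ∈ F) (ht' : t' ∈ F) (hne : t ≠ t') :
    μ (((fun x => x + t) '' T) ∩ ((fun x => x + t') '' T)) = 0 := by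
  classical
  have himg : ∀ s : E, μ ((fun x => x + s) '' T) = μ T := fun s => by
    simp
  have hcl : ∀ s : E, IsClosed ((fun x => x + s) '' T) := fun s =>
    (Homeomorph.addRight s).isClosed_image.2 hT
  -- Only the part of `T + t'` outside `T + t` is needed for the covering; the count forces this
  -- part to have full measure.
  have hsub : T + (F : Set E) ⊆ (⋃ s ∈ F.erase t', (fun x => x + s) '' T) ∪
      (((fun x => x + t') '' T) \ ((fun x => x + t) '' T)) := by
    rintro _ ⟨x, hx, s, hs, rfl⟩
    by_cases hst : s = t'
    · subst hst
      by_cases hxt : x + s ∈ (fun x => x + t) '' T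
      · exact Or.inl (Set.mem_biUnion (Finset.mem_coe.2 (Finset.mem_erase.2 ⟨hne, ht⟩)) hxt)
      · exact Or.inr ⟨⟨x, hx, rfl⟩, hxt⟩
    · exact Or.inl (Set.mem_biUnion (Finset.mem_coe.2 (Finset.mem_erase.2 ⟨hst, hs⟩)) ⟨x, hx, rfl⟩)
  have h1 : F.card * μ T ≤ (F.erase t').card * μ T +
      μ (((fun x => x + t') '' T) \ ((fun x => x + t) '' T)) := by
    refine hF.trans ((measure_mono hsub).trans ((measure_union_le _ _).trans ?_))
    gcongr
    refine (measure_biUnion_finset_le _ _).trans ?_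
    simp
  have h2 : μ T ≤ μ (((fun x => x + t') '' T) \ ((fun x => x + t) '' T)) := by
    rw [← Finset.card_erase_add_one ht', Nat.cast_add, Nat.cast_one, add_mul, one_mul] at h1
    exact (ENNReal.add_le_add_iff_left (ENNReal.mul_ne_top (ENNReal.natCast_ne_top _) hfin)).1 h1
  have h3 := measure_inter_add_sdiff (μ := μ) ((fun x => x + t') '' T) (hcl t).measurableSet
  rw [himg] at h3
  have h4 : μ (((fun x => x + t') '' T) ∩ ((fun x => x + t) '' T)) + μ T ≤ 0 + μ T := by
    rw [zero_add]
    calc _ ≤ _ := add_le_add le_rfl h2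
      _ = _ := h3
  rw [Set.inter_comm]
  exact le_antisymm ((ENNReal.add_le_add_iff_right hfin).1 h4) bot_le

open Filter in
/-- A compact set `T` with interior such that `M T = T + D`, where `M` is expanding and `D` has at
most `|det M|` elements. -/
structure IsExpandingTile {E : Type*} [NormedAddCommGroup E] [NormedSpace ℝ E]
    (M : E ≃L[ℝ] E) (D : Finset E) (T : Set E) : Prop where
  isCompact : IsCompact T
  interior_nonempty : (interior T).Nonempty
  image_eq : M '' T = T + (D : Set E)
  card_le : (D.card : ℝ) ≤ |LinearMap.det ((M : E →L[ℝ] E) : E →ₗ[ℝ] E)|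
  contracting : ∀ R ε : ℝ, 0 < ε → ∀ᶠ k : ℕ in atTop, ∀ x : E, ‖x‖ ≤ R → ‖(M ^ k).symm x‖ < ε

open Classical in
/-- The digit set of the `k`-th power of `M`. -/
noncomputable def powDigits {E : Type*} [NormedAddCommGroup E] [NormedSpace ℝ E]
    (M : E ≃L[ℝ] E) (D : Finset E) : ℕ → Finset E
  | 0 => {0}
  | k + 1 => powDigits M D k + D.image (M ^ k)

namespace IsExpandingTile

open Filter Topology MeasureTheory

variable {E : Type*} [NormedAddCommGroup E] [NormedSpace ℝ E]
  {M : E ≃L[ℝ] E} {D : Finset E} {T : Set E}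

theorem pow_image_eq (h : IsExpandingTile M D T) (k : ℕ) :
    (M ^ k) '' T = T + (powDigits M D k : Set E) := by
  classical
  induction k with
  | zero =>
    rw [powDigits, Finset.coe_singleton, Set.add_singleton]
    simp only [add_zero, Set.image_id']
    exact Set.image_id' T
  | succ k ih =>
    have h1 : (M ^ (k + 1)) '' T = (M ^ k) '' (M '' T) := by
      rw [pow_succ, Set.image_image]; rfl
    rw [h1, h.image_eq, Set.image_add, ih, powDigits, Finset.coe_add, Finset.coe_image, add_assoc]

theorem det_pow (M : E ≃L[ℝ] E) (k : ℕ) :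
    LinearMap.det ((M ^ k : E ≃L[ℝ] E) : E →ₗ[ℝ] E) = LinearMap.det (M : E →ₗ[ℝ] E) ^ k := by
  have : ((M ^ k : E ≃L[ℝ] E) : E →ₗ[ℝ] E) = (M : E →ₗ[ℝ] E) ^ k := by
    induction k with
    | zero => rfl
    | succ k ih => rw [pow_succ, pow_succ, ← ih]; rfl
  rw [this, map_pow]

theorem card_powDigits_le (h : IsExpandingTile M D T) (k : ℕ) :
    ((powDigits M D k).card : ℝ) ≤ |LinearMap.det ((M ^ k : E ≃L[ℝ] E) : E →ₗ[ℝ] E)| := by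
  classical
  rw [det_pow, abs_pow]
  refine le_trans ?_ (pow_le_pow_left₀ (Nat.cast_nonneg _) h.card_le k)
  norm_cast
  induction k with
  | zero => simp [powDigits]
  | succ k ih =>
    rw [powDigits, pow_succ]
    exact (Finset.card_add_le).trans (Nat.mul_le_mul ih Finset.card_image_le)

/-- The volume of `Mᵏ T` is `|det M|ᵏ` times that of `T`, with at most that many translates to fill
it; there is no volume to spare for overlaps. -/
theorem measure_inter_eq_zero [FiniteDimensional ℝ E] [MeasurableSpace E] [BorelSpace E]
    (μ : Measure E) [μ.IsAddHaarMeasure] (h : IsExpandingTile M D T) {k : ℕ} {t t' : E}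
    (ht : t ∈ powDigits M D k) (ht' : t' ∈ powDigits M D k) (hne : t ≠ t') :
    μ (((fun x => x + t) '' T) ∩ ((fun x => x + t') '' T)) = 0 := by
  refine measure_inter_translates_eq_zero h.isCompact.isClosed h.isCompact.measure_lt_top.ne
    ?_ ht ht' hne
  rw [← h.pow_image_eq]
  have h2 := Measure.addHaar_image_continuousLinearEquiv μ (M ^ k) T
  rw [h2]
  gcongr
  have := h.card_powDigits_le k
  rw [← ENNReal.ofReal_natCast]
  exact ENNReal.ofReal_le_ofReal this

/-- Every point of `T` lies in a copy `M⁻ᵏ(T + t)` of arbitrarily small diameter, and each copy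
brings interior points of its own. -/
theorem subset_closure_interior (h : IsExpandingTile M D T) : T ⊆ closure (interior T) := by
  intro x hx
  rw [Metric.mem_closure_iff]
  intro ε hε
  obtain ⟨R, hR⟩ := h.isCompact.isBounded.exists_norm_le
  obtain ⟨k, hk⟩ := (h.contracting (R + R) ε hε).exists
  obtain ⟨y, hy, t, ht, hyt⟩ : (M ^ k) x ∈ T + (powDigits M D k : Set E) := by
    rw [← h.pow_image_eq]; exact ⟨x, hx, rfl⟩
  obtain ⟨v, hv⟩ := h.interior_nonempty
  refine ⟨(M ^ k).symm (v + t), ?_, ?_⟩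
  · refine interior_maximal (s := T) (t := (fun z => (M ^ k) z - t) ⁻¹' interior T) ?_ ?_ ?_
    · intro z hz
      have h1 : (M ^ k) z ∈ T + (powDigits M D k : Set E) :=
        ⟨_, interior_subset hz, t, ht, by simp⟩
      rw [← h.pow_image_eq] at h1
      obtain ⟨w, hw, hwz⟩ := h1
      rwa [← (M ^ k).injective hwz]
    · exact isOpen_interior.preimage (by fun_prop)
    · simpa using hv
  · have h1 : x = (M ^ k).symm (y + t) := by
      rw [show y + t = (M ^ k) x from hyt]; simp
    rw [h1, dist_eq_norm, ← map_sub]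
    apply hk
    rw [add_sub_add_right_eq_sub]
    exact (norm_sub_le _ _).trans (add_le_add (hR y hy) (hR v (interior_subset hv)))

/-- Regularity upgrades a null overlap: a point of one translate interior to another would produce a
nonempty open overlap. -/
theorem eq_of_mem_interior [FiniteDimensional ℝ E]
    (h : IsExpandingTile M D T) {k : ℕ} {t t' x : E}
    (ht : t ∈ powDigits M D k) (ht' : t' ∈ powDigits M D k) (hx : x - t ∈ interior T)
    (hx' : x - t' ∈ T) : t = t' := by
  by_contra hne
  let _ : MeasurableSpace E := borel E
  have : BorelSpace E := ⟨rfl⟩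
  have h0 := h.measure_inter_eq_zero Measure.addHaar ht ht' hne
  have h1 : IsOpen ((fun z : E => z - t) ⁻¹' interior T ∩ (fun z : E => z - t') ⁻¹' interior T) :=
    (isOpen_interior.preimage (by fun_prop)).inter (isOpen_interior.preimage (by fun_prop))
  have h2 : ((fun z : E => z - t) ⁻¹' interior T ∩
      (fun z : E => z - t') ⁻¹' interior T).Nonempty := by
    have hop : IsOpen ((fun w : E => w + t' - t) ⁻¹' interior T) :=
      isOpen_interior.preimage (by fun_prop)
    obtain ⟨w, hw1, hw2⟩ := mem_closure_iff.1 (h.subset_closure_interior hx') _ hop (by simpa)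
    exact ⟨w + t', hw1, by simpa using hw2⟩
  refine (h1.measure_pos Measure.addHaar h2).ne' (measure_mono_null ?_ h0)
  rintro z ⟨hz1, hz2⟩
  exact ⟨⟨z - t, interior_subset hz1, by simp⟩, ⟨z - t', interior_subset hz2, by simp⟩⟩

/-- A tile with a polyhedral corner is, in suitable affine coordinates, a union of unit cells. -/
theorem exists_basis_of_corner [FiniteDimensional ℝ E] {m : ℕ} (h : IsExpandingTile M D T)
    {a : Fin m → E} {β : E →L[ℝ] ℝ} (hβ : ∀ j, 0 < β (a j)) {x₀ : E} (hx₀ : x₀ ∈ T)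
    {r : ℝ} (hr : 0 < r)
    (hcorner : Metric.ball x₀ r ∩ T = (fun x => x₀ + x) '' (Metric.ball 0 r ∩ genCone a)) :
    ∃ (N : E ≃L[ℝ] E) (y : E) (n : ℕ) (b : Module.Basis (Fin n) ℝ E) (K : Finset (Fin n → ℕ)),
      0 ∈ K ∧ ∀ x, N x + y ∈ T ↔
        ∃ k ∈ K, ∀ i, (k i : ℝ) ≤ b.repr x i ∧ b.repr x i ≤ (k i : ℝ) + 1 := by
  have hmem : ∀ x, ‖x‖ < r → (x ∈ genCone a ↔ x₀ + x ∈ T) := by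
    intro x hxr
    constructor
    · intro hx
      have : x₀ + x ∈ Metric.ball x₀ r ∩ T := by
        rw [hcorner]; exact ⟨x, ⟨by simpa using hxr, hx⟩, rfl⟩
      exact this.2
    · intro hx
      have : x₀ + x ∈ Metric.ball x₀ r ∩ T := ⟨by simpa using hxr, hx⟩
      rw [hcorner] at this
      obtain ⟨x', hx', heq⟩ := this
      rw [← add_left_cancel heq]
      exact hx'.2
  -- the height `β` controls the norm on the cone
  set κ : ℝ := ∑ j, ‖a j‖ / β (a j) with hκ
  have hκ0 : 0 ≤ κ := Finset.sum_nonneg fun j _ => div_nonneg (norm_nonneg _) (hβ j).le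
  have hnorm : ∀ x ∈ genCone a, ‖x‖ ≤ κ * β x := by
    rintro _ ⟨c, hc, rfl⟩
    refine (norm_sum_le _ _).trans ?_
    simp only [map_sum, map_smul, smul_eq_mul, Finset.mul_sum]
    refine Finset.sum_le_sum fun j _ => ?_
    rw [norm_smul, Real.norm_of_nonneg (hc j)]
    have h1 : ‖a j‖ / β (a j) ≤ κ := Finset.single_le_sum (f := fun j => ‖a j‖ / β (a j))
      (fun j _ => div_nonneg (norm_nonneg _) (hβ j).le) (Finset.mem_univ j)
    rw [div_le_iff₀ (hβ j)] at h1
    nlinarith [hc j]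
  -- Scales: height below `ρ` in the cone means norm below `r / 2`; `δ = ρ / (m + 2)` leaves room
  -- for `(m + 1) * δ < ρ`; pieces of diameter below `ε` move by less than `r / 2` and have heights
  -- below `δ`.
  set ρ : ℝ := r / (2 * (κ + 1)) with hρ
  have hρ0 : 0 < ρ := by positivity
  have hρr : ∀ x ∈ genCone a, β x < ρ → ‖x‖ < r / 2 := by
    intro x hx hxρ
    have h1 := hnorm x hx
    have h2 : ρ * (κ + 1) = r / 2 := by rw [hρ]; field_simp
    nlinarith
  set δ : ℝ := ρ / (m + 2) with hδ
  have hδ0 : 0 < δ := by positivity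
  have hδρ : (m + 2) * δ = ρ := by rw [hδ]; field_simp
  set ε : ℝ := min (r / 2) (δ / (‖β‖ + 1)) with hε
  have hε0 : 0 < ε := by positivity
  obtain ⟨R, hR⟩ := h.isCompact.isBounded.exists_norm_le
  obtain ⟨k, hk⟩ := (h.contracting (R + R) ε hε0).exists
  set N : E ≃L[ℝ] E := M ^ k with hN
  obtain ⟨y, hy, t₀, ht₀, hyt⟩ : N x₀ ∈ T + (powDigits M D k : Set E) := by
    rw [← h.pow_image_eq]; exact ⟨x₀, hx₀, rfl⟩
  have hyt : y + t₀ = N x₀ := hyt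
  -- The small piece of `T` that contains `x₀`, moved so that `x₀` becomes the origin.
  set T' : Set E := {x | N x + y ∈ T} with hT'
  have hsmall : ∀ x ∈ T', ∀ w ∈ T', ‖x - w‖ < ε := by
    intro x hx w hw
    have := hk ((N x + y) - (N w + y)) ((norm_sub_le _ _).trans (add_le_add (hR _ hx) (hR _ hw)))
    rwa [add_sub_add_right_eq_sub, ← map_sub, ContinuousLinearEquiv.symm_apply_apply] at this
  have h0T' : (0 : E) ∈ T' := by simpa [hT'] using hy
  -- Only pieces reaching the ball of radius `r / 2` are kept; being small, they stay within radius
  -- `r`, where `T` agrees with the cone.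
  set J : Set E := {j | ∃ t ∈ powDigits M D k, N j = t - t₀ ∧ ∃ w ∈ T', ‖w + j‖ < r / 2} with hJ
  let f : E ≃ₜ E := N.toHomeomorph.trans (Homeomorph.addRight y)
  have hfT : T' = f ⁻¹' T := rfl
  have hint : ∀ x, x ∈ interior T' ↔ N x + y ∈ interior T := by
    intro x
    rw [hfT, ← f.preimage_interior]
    rfl
  have hJT : ∀ j ∈ J, ∀ x ∈ T', x + j ∈ genCone a := by
    rintro j ⟨t, ht, hjt, w, hw, hwj⟩ x hx
    rw [hmem]
    · have h1 : N (x₀ + (x + j)) ∈ T + (powDigits M D k : Set E) := by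
        refine ⟨N x + y, hx, t, ht, ?_⟩
        simp only [map_add, hjt, ← hyt]
        abel
      rw [← h.pow_image_eq] at h1
      obtain ⟨z, hz, hzx⟩ := h1
      rwa [← N.injective hzx]
    · have h1 : x + j = (w + j) + (x - w) := by abel
      rw [h1]
      have h2 := (hsmall x hx w hw).trans_le (min_le_left _ _)
      exact (norm_add_le _ _).trans_lt (by linarith)
  have h0J : (0 : E) ∈ J := ⟨t₀, ht₀, by simp, 0, h0T', by simpa using hr⟩
  have hlocal : IsLocalConeTiling a β T' J δ ρ :=
    { pos := hβ
      finite := by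
        refine (((powDigits M D k).finite_toSet).image fun t => N.symm (t - t₀)).subset ?_
        rintro j ⟨t, ht, hjt, -⟩
        exact ⟨t, ht, by simp [← hjt]⟩
      isCompact := f.isCompact_preimage.2 h.isCompact
      regular := by
        rw [hfT, ← f.preimage_interior, ← f.preimage_closure]
        exact Set.preimage_mono h.subset_closure_interior
      zero_mem := h0T'
      subset := fun x hx => by simpa using hJT 0 h0J x hx
      lt := fun x hx => by
        have h1 := (hsmall x hx 0 h0T').trans_le (min_le_right _ _)
        rw [sub_zero, lt_div_iff₀ (by positivity)] at h1
        have h2 := (le_abs_self _).trans (β.le_opNorm x)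
        nlinarith [norm_nonneg x, norm_nonneg β]
      lt' := by
        have : (0 : ℝ) ≤ m := Nat.cast_nonneg _
        nlinarith
      translate_subset := hJT
      covering := fun x hx hxρ => by
        have hxr := hρr x hx hxρ
        have h1 := (hmem x (by linarith)).1 hx
        obtain ⟨z, hz, t, ht, hzt⟩ : N (x₀ + x) ∈ T + (powDigits M D k : Set E) := by
          rw [← h.pow_image_eq]; exact ⟨_, h1, rfl⟩
        have hzt : z + t = N (x₀ + x) := hzt
        have hxj : x - N.symm (t - t₀) ∈ T' := by
          have : N (x - N.symm (t - t₀)) + y = z := by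
            rw [map_sub, ContinuousLinearEquiv.apply_symm_apply]
            rw [map_add, ← hyt] at hzt
            rw [eq_sub_of_add_eq hzt]
            abel
          rwa [hT', Set.mem_ofPred_eq, this]
        exact ⟨N.symm (t - t₀), ⟨t, ht, by simp, _, hxj, by simpa using hxr⟩, hxj⟩
      disjoint := by
        rintro j ⟨t, ht, hjt, -⟩ j' ⟨t', ht', hjt', -⟩ x hx hx'
        rw [hint] at hx
        have hx' : N (x - j') + y ∈ T := hx'
        have : t = t' := by
          refine h.eq_of_mem_interior (x := N x + t₀ + y) ht ht' ?_ ?_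
          · convert hx using 1
            rw [map_sub, hjt]; abel
          · convert hx' using 1
            rw [map_sub, hjt']; abel
        apply N.injective
        rw [hjt, hjt', this] }
  obtain ⟨n, b, K, hK0, hK⟩ := hlocal.exists_basis (by
    rw [Fintype.card_fin]
    nlinarith)
  refine ⟨N, y, n, b, K, hK0, fun x => ?_⟩
  rw [show (N x + y ∈ T) ↔ x ∈ T' from Iff.rfl, hK]
  rfl

end IsExpandingTile

/-! ### Change of coordinates and tilings of the whole orthant -/

namespace IsExpandingTile

open Filter Topology MeasureTheory

theorem pow {E : Type*} [NormedAddCommGroup E] [NormedSpace ℝ E]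
    {M : E ≃L[ℝ] E} {D : Finset E} {T : Set E} (h : IsExpandingTile M D T) {p : ℕ} (hp : 0 < p) :
    IsExpandingTile (M ^ p) (powDigits M D p) T where
  isCompact := h.isCompact
  interior_nonempty := h.interior_nonempty
  image_eq := h.pow_image_eq p
  card_le := h.card_powDigits_le p
  contracting := fun R ε hε => by
    have h1 : Tendsto (fun k : ℕ => p * k) atTop atTop :=
      tendsto_id.const_mul_atTop' hp
    filter_upwards [h1.eventually (h.contracting R ε hε)] with k hk x hx
    rw [← pow_mul]
    exact hk x hx

/-- Affine change of coordinates for expanding tiles. -/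
theorem map {E : Type*} [NormedAddCommGroup E] [NormedSpace ℝ E]
    {M : E ≃L[ℝ] E} {D : Finset E} {T : Set E} (h : IsExpandingTile M D T)
    (L : E ≃L[ℝ] E) (c : E) :
    ∃ D' : Finset E, IsExpandingTile (L * M * L⁻¹) D' ((fun x => L x + c) '' T) := by
  classical
  have hmul : ∀ (f g : E ≃L[ℝ] E) (x : E), (f * g) x = f (g x) := fun f g x => rfl
  have hinv : ∀ x, L⁻¹ (L x) = x := fun x => L.symm_apply_apply x
  let f : E ≃ₜ E := L.toHomeomorph.trans (Homeomorph.addRight c)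
  refine ⟨D.image fun d => L d + (L (M (L⁻¹ c)) - c), ?_, ?_, ?_, ?_, ?_⟩
  · exact h.isCompact.image f.continuous
  · refine (h.interior_nonempty.image f).mono ?_
    rw [f.image_interior]
    exact subset_rfl
  · ext x
    constructor
    · rintro ⟨_, ⟨y, hy, rfl⟩, rfl⟩
      obtain ⟨z, hz, d, hd, hzd⟩ : M y ∈ T + (D : Set E) := by
        rw [← h.image_eq]; exact ⟨y, hy, rfl⟩
      have hzd : z + d = M y := hzd
      refine ⟨L z + c, ⟨z, hz, rfl⟩, _, Finset.mem_coe.2 (Finset.mem_image_of_mem _ hd), ?_⟩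
      simp only [hmul, map_add, hinv, ← hzd]
      abel
    · rintro ⟨_, ⟨z, hz, rfl⟩, e, he, rfl⟩
      obtain ⟨d, hd, rfl⟩ := Finset.mem_image.1 (Finset.mem_coe.1 he)
      obtain ⟨y, hy, hyz⟩ : z + d ∈ M '' T := by
        rw [h.image_eq]; exact ⟨z, hz, d, hd, rfl⟩
      refine ⟨L y + c, ⟨y, hy, rfl⟩, ?_⟩
      simp only [hmul, map_add, hinv, hyz]
      abel
  · refine le_trans (by exact_mod_cast Finset.card_image_le) (h.card_le.trans (le_of_eq ?_))
    congr 1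
    exact (LinearMap.det_conj (M : E →ₗ[ℝ] E) L.toLinearEquiv).symm
  · intro R ε hε
    have hconj : ∀ (k : ℕ) (x : E), ((L * M * L⁻¹) ^ k).symm x = L ((M ^ k).symm (L⁻¹ x)) := by
      intro k x
      rw [conj_pow]
      rfl
    filter_upwards [h.contracting (‖(L⁻¹ : E ≃L[ℝ] E).toContinuousLinearMap‖ * R)
      (ε / (‖L.toContinuousLinearMap‖ + 1)) (by positivity)] with k hk x hx
    rw [hconj]
    have h1 := hk (L⁻¹ x) (((L⁻¹ : E ≃L[ℝ] E).toContinuousLinearMap.le_opNorm x).trans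
      (mul_le_mul_of_nonneg_left hx (norm_nonneg _)))
    rw [lt_div_iff₀ (by positivity)] at h1
    have h2 := L.toContinuousLinearMap.le_opNorm ((M ^ k).symm (L⁻¹ x))
    refine lt_of_le_of_lt h2 ?_
    by_cases h0 : ‖(M ^ k).symm (L⁻¹ x)‖ = 0
    · rw [h0]; simpa using hε
    · have := lt_of_le_of_ne (norm_nonneg _) (Ne.symm h0)
      nlinarith

theorem powDigits_mono {E : Type*} [NormedAddCommGroup E] [NormedSpace ℝ E]
    {M : E ≃L[ℝ] E} {D : Finset E} (h0 : (0 : E) ∈ D) : Monotone (powDigits M D) := by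
  classical
  refine monotone_nat_of_le_succ fun k t ht => ?_
  rw [powDigits]
  have := Finset.add_mem_add ht (Finset.mem_image_of_mem (M ^ k) h0)
  simpa using this

variable {n : ℕ} {M : EuclideanSpace ℝ (Fin n) ≃L[ℝ] EuclideanSpace ℝ (Fin n)}
  {D : Finset (EuclideanSpace ℝ (Fin n))} {T : Set (EuclideanSpace ℝ (Fin n))}

/-- The sets `Mᵏ T = T + powDigits M D k` stay in the orthant and exhaust it, since `M⁻ᵏ` brings any
of its points into the unit cube. As `0 ∈ D`, the digit sets are nested and `J` can be their union.
-/
theorem isTileOf_orthant_of_map_orthant (h : IsExpandingTile M D T) (hT : T ⊆ orthant n)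
    (hcube : unitCube n ⊆ T) (hM : ∀ x ∈ orthant n, M x ∈ orthant n)
    (hM' : ∀ x ∈ orthant n, M.symm x ∈ orthant n) : IsTileOf (orthant n) T := by
  have h0T : (0 : EuclideanSpace ℝ (Fin n)) ∈ T := hcube fun i => by simp
  have hpow : ∀ k : ℕ, ∀ x ∈ orthant n, (M ^ k) x ∈ orthant n := by
    intro k
    induction k with
    | zero => exact fun x hx => hx
    | succ k ih => exact fun x hx => by rw [pow_succ]; exact ih _ (hM x hx)
  have hpow' : ∀ k : ℕ, ∀ x ∈ orthant n, (M ^ k).symm x ∈ orthant n := by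
    intro k
    induction k with
    | zero => exact fun x hx => hx
    | succ k ih => exact fun x hx => by rw [pow_succ]; exact hM' _ (ih x hx)
  have hsum : ∀ k, T + (powDigits M D k : Set _) ⊆ orthant n := by
    intro k
    rw [← h.pow_image_eq]
    rintro _ ⟨x, hx, rfl⟩
    exact hpow k x (hT hx)
  have h0D : (0 : EuclideanSpace ℝ (Fin n)) ∈ D := by
    obtain ⟨y, hy, t, ht, hyt⟩ : (0 : EuclideanSpace ℝ (Fin n)) ∈ T + (D : Set _) := by
      rw [← h.image_eq]; exact ⟨0, h0T, by simp⟩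
    have hyt : y + t = 0 := hyt
    have ht0 : t ∈ orthant n := by
      have h1 : 0 + t ∈ T + (D : Set _) := ⟨0, h0T, t, ht, rfl⟩
      rw [← h.image_eq] at h1
      obtain ⟨x, hx, hxt⟩ := h1
      rw [zero_add] at hxt
      rw [← hxt]
      exact hM x (hT hx)
    have : t = 0 := by
      ext i
      have h1 := hT hy i
      have h2 := ht0 i
      have h3 : y i + t i = 0 := by rw [← PiLp.add_apply, hyt]; rfl
      simp only [PiLp.zero_apply]
      linarith
    rwa [← this]
  have hmono := powDigits_mono (M := M) h0D
  set J : Set (EuclideanSpace ℝ (Fin n)) := ⋃ k, (powDigits M D k : Set _) with hJ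
  have hpair : ∀ t ∈ J, ∀ t' ∈ J, ∃ k, t ∈ powDigits M D k ∧ t' ∈ powDigits M D k := by
    intro t ht t' ht'
    obtain ⟨k, hk⟩ := Set.mem_iUnion.1 ht
    obtain ⟨l, hl⟩ := Set.mem_iUnion.1 ht'
    exact ⟨max k l, hmono (le_max_left k l) hk, hmono (le_max_right k l) hl⟩
  refine ⟨J, h.isCompact, ?_, ⟨?_, ?_⟩, ?_⟩
  · refine ⟨DiscreteTopology.of_forall_le_dist one_pos ?_⟩
    rintro ⟨t, ht⟩ ⟨t', ht'⟩ hne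
    by_contra hlt
    rw [Subtype.dist_eq, not_le, dist_eq_norm] at hlt
    have hlt : ‖t - t'‖ < 1 := hlt
    obtain ⟨k, hk, hk'⟩ := hpair t ht t' ht'
    have hcoord : ∀ i, |t i - t' i| < 1 := fun i =>
      lt_of_le_of_lt (by simpa using PiLp.norm_apply_le (t - t') i) hlt
    -- The midpoint of the centres of the unit cubes at `t` and `t'`; it is interior to both.
    set x : EuclideanSpace ℝ (Fin n) := (1 / 2 : ℝ) • (t + t' + WithLp.toLp 2 fun _ => 1) with hx
    have hxi : ∀ i, x i = (t i + t' i + 1) / 2 := fun i => by simp [hx]; ring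
    have hopen : IsOpen {z : EuclideanSpace ℝ (Fin n) | ∀ i, 0 < z i ∧ z i < 1} := by
      simp only [Set.ofPred_forall]
      exact isOpen_iInter_of_finite fun i => (isOpen_lt continuous_const
        (EuclideanSpace.proj i).continuous).and
        (isOpen_lt (EuclideanSpace.proj i).continuous continuous_const)
    refine hne (Subtype.ext (h.eq_of_mem_interior (x := x) hk hk' ?_ ?_))
    · refine interior_maximal (fun z hz => hcube fun i => ⟨(hz i).1.le, (hz i).2.le⟩) hopen ?_
      intro i
      have := abs_lt.1 (hcoord i)
      simp only [PiLp.sub_apply, hxi]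
      constructor <;> linarith
    · refine hcube fun i => ?_
      have := abs_lt.1 (hcoord i)
      simp only [PiLp.sub_apply, hxi]
      constructor <;> linarith
  · rintro _ ⟨x, hx, t, ht, rfl⟩
    obtain ⟨k, hk⟩ := Set.mem_iUnion.1 ht
    exact hsum k ⟨x, hx, t, hk, rfl⟩
  · intro t ht t' ht' hne
    obtain ⟨k, hk, hk'⟩ := hpair t ht t' ht'
    exact h.measure_inter_eq_zero volume hk hk' hne
  · intro x hx
    obtain ⟨k, hk⟩ := (h.contracting ‖x‖ 1 one_pos).exists
    have h1 : (M ^ k).symm x ∈ T := by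
      refine hcube fun i => ⟨hpow' k x hx i, ?_⟩
      exact (le_abs_self _).trans ((PiLp.norm_apply_le ((M ^ k).symm x) i).trans (hk x le_rfl).le)
    obtain ⟨y, hy, t, ht, hyt⟩ : x ∈ T + (powDigits M D k : Set _) := by
      rw [← h.pow_image_eq]; exact ⟨_, h1, by simp⟩
    exact ⟨y, hy, t, Set.mem_iUnion.2 ⟨k, ht⟩, hyt⟩

/-- An expanding tile that is a union of unit cells, including the cell at the origin, tiles the
orthant. -/
theorem isTileOf_orthant (h : IsExpandingTile M D T) {K : Finset (Fin n → ℕ)} (hK0 : 0 ∈ K)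
    (hK : ∀ x, x ∈ T ↔ ∃ k ∈ K, ∀ i, (k i : ℝ) ≤ x i ∧ x i ≤ (k i : ℝ) + 1) :
    IsTileOf (orthant n) T := by
  have hT : T ⊆ orthant n := fun x hx i => by
    obtain ⟨k, -, hx⟩ := (hK x).1 hx
    exact (Nat.cast_nonneg _).trans (hx i).1
  have hcube : unitCube n ⊆ T := fun x hx => (hK x).2 ⟨0, hK0, fun i => by simpa using hx i⟩
  have h0T : (0 : EuclideanSpace ℝ (Fin n)) ∈ T := hcube fun i => by simp
  have hnear : ∀ᶠ z in 𝓝 (0 : EuclideanSpace ℝ (Fin n)), z ∈ orthant n → z ∈ T := by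
    filter_upwards [Metric.ball_mem_nhds (0 : EuclideanSpace ℝ (Fin n)) one_pos] with z hz hz0
    refine hcube fun i => ⟨hz0 i, (le_abs_self _).trans ((PiLp.norm_apply_le z i).trans ?_)⟩
    exact (by simpa using hz : ‖z‖ < 1).le
  have hzero : ∀ (N : EuclideanSpace ℝ (Fin n) ≃L[ℝ] EuclideanSpace ℝ (Fin n)) (v : _),
      N.symm v ∈ orthant n → N.symm (-v) ∈ orthant n → v = 0 := by
    intro N v h1 h2
    have : N.symm v = 0 := by
      ext i
      have h1 := h1 i
      have h2 := h2 i
      simp only [map_neg, PiLp.neg_apply, PiLp.zero_apply] at h1 h2 ⊢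
      linarith
    simpa using this
  -- the piece of the `k`-th subdivision at the origin sits at the point `x k` of the tile
  have hx : ∀ k : ℕ, ∃ x ∈ T, -x ∈ powDigits M D k := fun k => by
    obtain ⟨x, hx, t, ht, hxt⟩ : (0 : EuclideanSpace ℝ (Fin n)) ∈ T + (powDigits M D k : Set _) := by
      rw [← h.pow_image_eq]; exact ⟨0, h0T, by simp⟩
    refine ⟨x, hx, ?_⟩
    rwa [neg_eq_of_add_eq_zero_right hxt]
  choose x hxT hxD using hx
  have hpiece : ∀ k, ∀ t ∈ powDigits M D k, ∀ y ∈ T, (M ^ k).symm (y + t) ∈ orthant n := by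
    intro k t ht y hy
    have h1 : y + t ∈ T + (powDigits M D k : Set _) := ⟨y, hy, t, ht, rfl⟩
    rw [← h.pow_image_eq] at h1
    obtain ⟨z, hz, hzy⟩ := h1
    rw [← hzy, ContinuousLinearEquiv.symm_apply_apply]
    exact hT hz
  have hsub : ∀ k, ∀ y ∈ T, (M ^ k).symm (y - x k) ∈ orthant n := fun k y hy => by
    rw [sub_eq_add_neg]; exact hpiece k _ (hxD k) y hy
  -- With `hsub`, this says that near `x k` the tile is `x k + Mᵏ(orthant)`: by pointedness only one
  -- piece contains the origin.
  have hgerm : ∀ k, ∀ᶠ z in 𝓝 (0 : EuclideanSpace ℝ (Fin n)), z ∈ orthant n →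
      (M ^ k) z + x k ∈ T := by
    intro k
    have h1 : ∀ᶠ z in 𝓝 (0 : EuclideanSpace ℝ (Fin n)), ∀ t ∈ powDigits M D k, -t ∉ T →
        (M ^ k) z - t ∉ T := by
      rw [eventually_all_finset]
      intro t _
      by_cases ht : -t ∈ T
      · exact Eventually.of_forall fun z hz => absurd ht hz
      · have hc : ContinuousAt (fun z => (M ^ k) z - t) 0 := by fun_prop
        filter_upwards [hc.eventually (h.isCompact.isClosed.isOpen_compl.mem_nhds
          (by simpa using ht))] with z hz _ using hz
    filter_upwards [h1, hnear] with z hz hzT hz0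
    obtain ⟨y, hy, t, ht, hyt⟩ : (M ^ k) z ∈ T + (powDigits M D k : Set _) := by
      rw [← h.pow_image_eq]; exact ⟨z, hzT hz0, rfl⟩
    have hyt : y + t = (M ^ k) z := hyt
    have htT : -t ∈ T := by
      by_contra hn
      exact hz t ht hn (by rw [← hyt]; simpa using hy)
    have : x k + t = 0 := hzero (M ^ k) _ (hpiece k t ht _ (hxT k)) (by
      have := hsub k _ htT
      convert this using 2
      abel)
    rw [← hyt]
    have h2 : y + t + x k = y := by rw [add_assoc, add_comm t, this, add_zero]
    rwa [h2]
  -- At a non-integral coordinate, `T` would contain a segment centred at `x k`, impossible at the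
  -- apex of a pointed cone.
  have hvert : ∀ k, ∀ i, ∃ j : ℕ, x k i = j := by
    intro k i
    obtain ⟨e, he, hxe⟩ := (hK _).1 (hxT k)
    by_contra hne
    push Not at hne
    have h1 : (e i : ℝ) < x k i := lt_of_le_of_ne (hxe i).1 (hne (e i)).symm
    have h2 : x k i < e i + 1 := lt_of_le_of_ne (hxe i).2 (by simpa using hne (e i + 1))
    set η : ℝ := min (x k i - e i) (e i + 1 - x k i) with hη
    have hη0 : 0 < η := lt_min (by linarith) (by linarith)
    have hη1 : η ≤ x k i - e i := min_le_left _ _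
    have hη2 : η ≤ e i + 1 - x k i := min_le_right _ _
    have hmem : ∀ s : ℝ, |s| ≤ η → x k + s • EuclideanSpace.single i (1 : ℝ) ∈ T := by
      intro s hs
      obtain ⟨hs1, hs2⟩ := abs_le.1 hs
      refine (hK _).2 ⟨e, he, fun j => ?_⟩
      by_cases hj : j = i
      · subst hj
        simp
        constructor <;> linarith
      · simpa [hj] using hxe j
    have h3 := hsub k _ (hmem η (abs_of_pos hη0).le)
    have h4 := hsub k _ (hmem (-η) (by rw [abs_neg]; exact (abs_of_pos hη0).le))
    rw [add_sub_cancel_left] at h3 h4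
    rw [neg_smul] at h4
    have h5 := congrArg (fun v : EuclideanSpace ℝ (Fin n) => v i) (hzero _ _ h3 h4)
    simp at h5
    exact hη0.ne' h5
  obtain ⟨R, hR⟩ := h.isCompact.isBounded.exists_norm_le
  have hfin : {v : EuclideanSpace ℝ (Fin n) | v ∈ T ∧ ∀ i, ∃ j : ℕ, v i = j}.Finite := by
    refine ((Set.finite_Iic (fun _ : Fin n => ⌊R⌋₊)).image
      fun k => (WithLp.toLp 2 fun i => (k i : ℝ) : EuclideanSpace ℝ (Fin n))).subset ?_
    rintro v ⟨hv, hvi⟩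
    choose k hk using hvi
    refine ⟨k, fun i => Nat.le_floor ?_, ?_⟩
    · rw [← hk]
      exact (le_abs_self _).trans ((PiLp.norm_apply_le v i).trans (hR v hv))
    · ext i; simp [hk]
  have hxmem : ∀ k, x k ∈ {v : EuclideanSpace ℝ (Fin n) | v ∈ T ∧ ∀ i, ∃ j : ℕ, v i = j} :=
    fun k => ⟨hxT k, hvert k⟩
  obtain ⟨k, l, hkl, hxkl⟩ := Set.Finite.exists_lt_map_eq_of_forall_mem hxmem hfin
  obtain ⟨p, rfl⟩ := Nat.exists_eq_add_of_lt hkl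
  -- Equal points give equal germs of `T`, hence equal cones `Mᵏ(orthant)` and `Mˡ(orthant)`.
  have hstep : ∀ k l : ℕ, x k = x l → ∀ z ∈ orthant n, (M ^ l).symm ((M ^ k) z) ∈ orthant n := by
    intro k l hkl z hz
    have hc : Tendsto (fun s : ℝ => s • z) (𝓝[>] 0) (𝓝 0) := by
      have : Continuous fun s : ℝ => s • z := by fun_prop
      simpa using (this.tendsto 0).mono_left nhdsWithin_le_nhds
    obtain ⟨s, hs1, hs⟩ := ((hc.eventually (hgerm k)).and self_mem_nhdsWithin).exists
    have hs : 0 < s := hs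
    have h1 := hsub l _ (hs1 fun i => mul_nonneg hs.le (hz i))
    rw [hkl, add_sub_cancel_right, map_smul, map_smul] at h1
    intro i
    have := h1 i
    rw [PiLp.smul_apply, smul_eq_mul] at this
    exact nonneg_of_mul_nonneg_right this hs
  refine (h.pow (Nat.succ_pos p)).isTileOf_orthant_of_map_orthant hT hcube ?_ ?_
  · intro z hz
    have h1 := hstep _ _ hxkl.symm z hz
    have h2 : (M ^ (k + p + 1)) z = (M ^ k) ((M ^ (p + 1)) z) := by
      rw [add_assoc, pow_add]; rfl
    rwa [h2, ContinuousLinearEquiv.symm_apply_apply] at h1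
  · intro z hz
    have h1 := hstep _ _ hxkl z hz
    have h2 : (M ^ k) z = (M ^ (k + p + 1)) ((M ^ (p + 1)).symm z) := by
      rw [add_assoc, pow_add]
      exact congrArg (M ^ k) ((M ^ (p + 1)).apply_symm_apply z).symm
    rwa [h2, ContinuousLinearEquiv.symm_apply_apply] at h1

end IsExpandingTile

/-! ### From eigenvalues to contraction -/

open Filter Topology in
/-- In a complex Banach algebra, the powers of an element whose spectrum lies in the open unit disc
tend to zero. -/
theorem tendsto_pow_zero_of_spectrum {R : Type*} [NormedRing R] [NormedAlgebra ℂ R]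
    [CompleteSpace R] [Nontrivial R] (a : R) (ha : ∀ μ ∈ spectrum ℂ a, ‖μ‖ < 1) :
    Tendsto (fun k : ℕ => a ^ k) atTop (𝓝 0) := by
  have h1 : spectralRadius ℂ a < (1 : NNReal) :=
    spectrum.spectralRadius_lt_of_forall_lt a fun μ hμ => by
      have := ha μ hμ
      rwa [← NNReal.coe_lt_coe, coe_nnnorm]
  obtain ⟨r, hr1, hr2⟩ := ENNReal.lt_iff_exists_nnreal_btwn.1 h1
  have h2 := (spectrum.pow_nnnorm_pow_one_div_tendsto_nhds_spectralRadius a).eventually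
    (gt_mem_nhds hr1)
  have hr : r < 1 := by exact_mod_cast hr2
  rw [tendsto_zero_iff_norm_tendsto_zero]
  refine squeeze_zero' (Eventually.of_forall fun k => norm_nonneg _) ?_
    (tendsto_pow_atTop_nhds_zero_of_lt_one r.coe_nonneg (by exact_mod_cast hr))
  filter_upwards [h2, eventually_gt_atTop 0] with k hk hk0
  have hk0' : (0 : ℝ) < k := by exact_mod_cast hk0
  have h3 := ENNReal.rpow_le_rpow hk.le hk0'.le
  rw [← ENNReal.rpow_mul, one_div_mul_cancel hk0'.ne', ENNReal.rpow_one, ENNReal.rpow_natCast]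
    at h3
  have h4 : ‖a ^ k‖₊ ≤ r ^ k := by exact_mod_cast h3
  exact_mod_cast h4

namespace IsExpanding

open Filter Topology

variable {n : ℕ} {A : Matrix (Fin n) (Fin n) ℝ}

/-- Over `ℂ` the spectrum of `A⁻¹` consists of inverses of eigenvalues of `A`, so it lies in the
open unit disc; real parts of entries carry the limit back to `ℝ`. -/
theorem tendsto_inv_pow (hA : IsExpanding A) (hdet : A.det ≠ 0) :
    Tendsto (fun k : ℕ => A⁻¹ ^ k) atTop (𝓝 0) := by
  rcases isEmpty_or_nonempty (Fin n) with hn | hn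
  · have : (fun k : ℕ => A⁻¹ ^ k) = fun _ => 0 := funext fun k => Subsingleton.elim _ _
    rw [this]
    exact tendsto_const_nhds
  let _ : NormedRing (Matrix (Fin n) (Fin n) ℂ) := Matrix.linftyOpNormedRing
  let _ : NormedAlgebra ℂ (Matrix (Fin n) (Fin n) ℂ) := Matrix.linftyOpNormedAlgebra
  set f : Matrix (Fin n) (Fin n) ℝ →+* Matrix (Fin n) (Fin n) ℂ := Complex.ofRealHom.mapMatrix
    with hf
  have hAi : A * A⁻¹ = 1 := Matrix.mul_nonsing_inv A (isUnit_iff_ne_zero.2 hdet)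
  have hiA : A⁻¹ * A = 1 := Matrix.nonsing_inv_mul A (isUnit_iff_ne_zero.2 hdet)
  let u : (Matrix (Fin n) (Fin n) ℂ)ˣ :=
    ⟨f A, f A⁻¹, by rw [← map_mul, hAi, map_one], by rw [← map_mul, hiA, map_one]⟩
  have hu : ∀ μ ∈ spectrum ℂ (f A⁻¹), ‖μ‖ < 1 := by
    intro μ hμ
    have h1 : μ ∈ (spectrum ℂ (u : Matrix (Fin n) (Fin n) ℂ))⁻¹ := by
      rw [spectrum.map_inv]; exact hμ
    have h2 := hA μ⁻¹ h1
    rw [norm_inv] at h2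
    have h3 : ‖μ‖ ≠ 0 := fun h => by rw [h, inv_zero] at h2; linarith
    have h4 : 0 < ‖μ‖ := lt_of_le_of_ne (norm_nonneg _) h3.symm
    exact (one_lt_inv₀ h4).1 h2
  have hlim := tendsto_pow_zero_of_spectrum _ hu
  refine tendsto_pi_nhds.2 fun i => tendsto_pi_nhds.2 fun j => ?_
  have h1 : Tendsto (fun k : ℕ => (f A⁻¹ ^ k) i j) atTop (𝓝 0) :=
    (tendsto_pi_nhds.1 ((tendsto_pi_nhds.1 hlim) i)) j
  have h2 := (Complex.continuous_re.tendsto 0).comp h1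
  refine (Complex.zero_re ▸ h2).congr fun k => ?_
  rw [Function.comp_apply, ← map_pow]
  rfl

end IsExpanding

/-- An invertible matrix as an automorphism of Euclidean space. -/
noncomputable def matrixEquiv {n : ℕ} (A : Matrix (Fin n) (Fin n) ℝ) (hdet : A.det ≠ 0) :
    EuclideanSpace ℝ (Fin n) ≃L[ℝ] EuclideanSpace ℝ (Fin n) :=
  (LinearEquiv.ofLinearMap (Matrix.toEuclideanLin A) (Matrix.toEuclideanLin A⁻¹)
    (by rw [← Matrix.toLpLin_mul_same, Matrix.mul_nonsing_inv A (isUnit_iff_ne_zero.2 hdet),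
      Matrix.toLpLin_one])
    (by rw [← Matrix.toLpLin_mul_same, Matrix.nonsing_inv_mul A (isUnit_iff_ne_zero.2 hdet),
      Matrix.toLpLin_one])).toContinuousLinearEquiv

open Filter Topology in
theorem IsSelfAffineTile.isExpandingTile {n : ℕ} {A : Matrix (Fin n) (Fin n) ℝ}
    {D : Finset (EuclideanSpace ℝ (Fin n))} {T : Set (EuclideanSpace ℝ (Fin n))}
    (h : IsSelfAffineTile A D T) (hdet : A.det ≠ 0) :
    IsExpandingTile (matrixEquiv A hdet) D T where
  isCompact := h.isSelfAffineSet.isCompact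
  interior_nonempty := h.interior_nonempty
  image_eq := by
    have hsymm : ∀ x, Matrix.toEuclideanLin A⁻¹ x = (matrixEquiv A hdet).symm x := fun x => rfl
    ext x
    constructor
    · rintro ⟨y, hy, rfl⟩
      rw [h.isSelfAffineSet.set_eq] at hy
      obtain ⟨d, hd, z, hz, rfl⟩ := Set.mem_iUnion₂.1 hy
      exact ⟨z, hz, d, hd, by simp only [hsymm, ContinuousLinearEquiv.apply_symm_apply]⟩
    · rintro ⟨z, hz, d, hd, rfl⟩
      refine ⟨(matrixEquiv A hdet).symm (z + d), ?_, by simp⟩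
      rw [h.isSelfAffineSet.set_eq]
      exact Set.mem_biUnion hd ⟨z, hz, rfl⟩
  card_le := by
    rw [← h.abs_det_eq]
    exact (congrArg abs (LinearMap.det_toLpLin 2 A)).ge
  contracting := by
    intro R ε hε
    have hsymm : ∀ (k : ℕ) (x : EuclideanSpace ℝ (Fin n)), ((matrixEquiv A hdet) ^ k).symm x =
        Matrix.toEuclideanCLM (𝕜 := ℝ) (A⁻¹ ^ k) x := by
      intro k
      induction k with
      | zero => intro x; rw [pow_zero, pow_zero, map_one]; rfl
      | succ k ih =>
        intro x
        rw [pow_succ, pow_succ', map_mul]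
        change (matrixEquiv A hdet).symm (((matrixEquiv A hdet) ^ k).symm x) = _
        rw [ih]
        rfl
    have hcont : Continuous fun B : Matrix (Fin n) (Fin n) ℝ =>
        Matrix.toEuclideanCLM (n := Fin n) (𝕜 := ℝ) B :=
      LinearMap.continuous_of_finiteDimensional
        (Matrix.toEuclideanCLM (n := Fin n) (𝕜 := ℝ)).toAlgEquiv.toLinearMap
    have h1 := ((hcont.tendsto 0).comp (h.isExpanding.tendsto_inv_pow hdet)).norm
    rw [map_zero, norm_zero] at h1
    have hε' : 0 < ε / (|R| + 1) := by positivity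
    filter_upwards [h1.eventually (gt_mem_nhds hε')] with k hk x hx
    rw [hsymm]
    refine lt_of_le_of_lt (ContinuousLinearMap.le_opNorm _ x) ?_
    rw [lt_div_iff₀ (by positivity)] at hk
    refine lt_of_le_of_lt ?_ hk
    exact mul_le_mul_of_nonneg_left (hx.trans ((le_abs_self R).trans (by linarith)))
      (norm_nonneg _)

/-! ### Assembly of the theorem -/

/-- Affine coordinates in which a tile with a polyhedral corner is a union of unit cells. -/
theorem IsExpandingTile.exists_affine_coordinates {n : ℕ}
    {M : EuclideanSpace ℝ (Fin n) ≃L[ℝ] EuclideanSpace ℝ (Fin n)}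
    {D : Finset (EuclideanSpace ℝ (Fin n))} {T : Set (EuclideanSpace ℝ (Fin n))}
    (h : IsExpandingTile M D T) (hcorner : HasPolyhedralCorner T) :
    ∃ (L : EuclideanSpace ℝ (Fin n) ≃L[ℝ] EuclideanSpace ℝ (Fin n))
      (c : EuclideanSpace ℝ (Fin n)) (K : Finset (Fin n → ℕ)), 0 ∈ K ∧
      ∀ x, x ∈ (fun x => L x + c) '' T ↔
        ∃ k ∈ K, ∀ i, (k i : ℝ) ≤ x i ∧ x i ≤ (k i : ℝ) + 1 := by
  obtain ⟨x₀, hx₀, r, hr, C, ⟨m, a, β, -, hβ, rfl⟩, hC⟩ := hcorner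
  obtain ⟨N, y, n', b, K, hK0, hK⟩ := h.exists_basis_of_corner (a := a) (β := innerSL ℝ β)
    (fun j => by rw [innerSL_apply_apply, real_inner_comm]; exact hβ j) hx₀ hr hC
  obtain rfl : n' = n := by
    have := Module.finrank_eq_card_basis b
    simpa using this.symm
  let L : EuclideanSpace ℝ (Fin n') ≃L[ℝ] EuclideanSpace ℝ (Fin n') :=
    N.symm.trans (b.equivFun.trans (WithLp.linearEquiv 2 ℝ (Fin n' → ℝ)).symm).toContinuousLinearEquiv
  have hL : ∀ v i, L v i = b.repr (N.symm v) i := fun v i => rfl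
  refine ⟨L, -L y, K, hK0, fun x => ?_⟩
  have h1 : x ∈ (fun x => L x + -L y) '' T ↔ L.symm x + y ∈ T := by
    constructor
    · rintro ⟨z, hz, rfl⟩
      simpa using hz
    · intro hx
      exact ⟨_, hx, by simp⟩
  have h2 : N (N.symm (L.symm x)) + y = L.symm x + y := by simp
  rw [h1, ← h2, hK]
  simp only [← hL, ContinuousLinearEquiv.apply_symm_apply]

theorem theorem1p4 {n : ℕ} (A : Matrix (Fin n) (Fin n) ℝ)
    (D : Finset (EuclideanSpace ℝ (Fin n))) (T : Set (EuclideanSpace ℝ (Fin n)))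
    (hT : IsSelfAffineTile A D T) (hcorner : HasPolyhedralCorner T) :
    (∃ φ : EuclideanSpace ℝ (Fin n) ≃ᵃ[ℝ] EuclideanSpace ℝ (Fin n),
      IsTileOf (orthant n) (φ '' T)) ∧
    (∃ (ψ : EuclideanSpace ℝ (Fin n) ≃ᵃ[ℝ] EuclideanSpace ℝ (Fin n))
      (E : Finset (EuclideanSpace ℝ (Fin n))),
      (E : Set (EuclideanSpace ℝ (Fin n))) ⊆ integerOrthant n ∧
      ψ '' T = (E : Set (EuclideanSpace ℝ (Fin n))) + unitCube n) := by
  classical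
  have hdet : A.det ≠ 0 := by
    intro h0
    have h1 := hT.abs_det_eq
    have h2 := hT.one_lt_card
    rw [h0, abs_zero] at h1
    have h3 : D.card = 0 := by exact_mod_cast h1.symm
    omega
  have h := hT.isExpandingTile hdet
  obtain ⟨L, c, K, hK0, hK⟩ := h.exists_affine_coordinates hcorner
  obtain ⟨D', hD'⟩ := h.map L c
  let φ : EuclideanSpace ℝ (Fin n) ≃ᵃ[ℝ] EuclideanSpace ℝ (Fin n) :=
    L.toLinearEquiv.toAffineEquiv.trans (AffineEquiv.constVAdd ℝ _ c)
  have hφ : (φ '' T) = (fun x => L x + c) '' T := by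
    refine Set.image_congr fun x _ => ?_
    exact add_comm c (L x)
  refine ⟨⟨φ, ?_⟩, φ, K.image fun k => WithLp.toLp 2 fun i => (k i : ℝ), ?_, ?_⟩
  · rw [hφ]
    exact hD'.isTileOf_orthant hK0 hK
  · intro x hx
    obtain ⟨k, -, rfl⟩ := Finset.mem_image.1 (Finset.mem_coe.1 hx)
    exact fun i => ⟨k i, rfl⟩
  · rw [hφ]
    ext x
    rw [hK]
    constructor
    · rintro ⟨k, hk, hx⟩
      refine ⟨_, Finset.mem_coe.2 (Finset.mem_image_of_mem _ hk),
        x - WithLp.toLp 2 fun i => (k i : ℝ), fun i => ?_, by simp⟩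
      have := hx i
      simp only [PiLp.sub_apply]
      constructor <;> linarith
    · rintro ⟨_, he, y, hy, rfl⟩
      obtain ⟨k, hk, rfl⟩ := Finset.mem_image.1 (Finset.mem_coe.1 he)
      refine ⟨k, hk, fun i => ?_⟩
      have := hy i
      simp only [PiLp.add_apply]
      constructor <;> linarith
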